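/- Let $(B,\mathfrak n)$ be a Noetherian local ring with $d=\dim B>0$ containing a field $k$ such that the composite map $k\to B\to B/\mathfrak n$ is bijective. Let $J$ be an $\mathfrak n$-primary ideal of $B$ and put $A=k+J\subseteq B$; then $A$ is a Noetherian local ring with maximal ideal $\mathfrak m=J$ and $\dim A=d$. Let $\mathfrak q=(a_1,\dots,a_d)B$ and $\mathfrak q'=(a_1',\dots,a_d')B$ be parameter ideals of $B$ which are reductions of $J$ (that is, $\mathfrak q\subseteq J$ and $J^{n+1}=\mathfrak qJ^n$ for some $n\ge 0$, and similarly for $\mathfrak q'$), and put $Q=(a_1,\dots,a_d)A$ and $Q'=(a_1',\dots,a_d')A$. For an ideal $I$ of $A$ that is $\mathfrak m$-primary, let $\mathrm e_I^i(A)\in\mathbb Z$ $(0\le i\le d)$ denote the Hilbert coefficients, defined by $$\ell_A(A/I^{n+1})=\sum_{i=0}^{d}(-1)^i\,\mathrm e_I^i(A)\binom{n+d-i}{d-i}\qquad\text{for all } n\gg 0.$$ Let $T=\mathcal R(Q)=A[Qt]\subseteq A[t]$ and $T'=\mathcal R(Q')=A[Q't]$ be the Rees algebras, let $\mathfrak p=\mathfrak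 mT$ and $\mathfrak p'=\mathfrak mT'$ (these are prime ideals), and let $$S=\mathfrak m\mathcal R(\mathfrak m)/\mathfrak m\mathcal R(Q)\cong\bigoplus_{n\ge1}\mathfrak m^{n+1}/Q^n\mathfrak m,\qquad S'=\mathfrak m\mathcal R(\mathfrak m)/\mathfrak m\mathcal R(Q')$$ be the Sally modules of $\mathfrak m$ with respect to $Q$ and $Q'$, regarded as modules over $T$ and $T'$ respectively. Then the lengths $\ell_{T_{\mathfrak p}}(S_{\mathfrak p})$ and $\ell_{T'_{\mathfrak p'}}(S'_{\mathfrak p'})$ are finite and $$\mathrm e_Q^1(A)+\ell_{T_{\mathfrak p}}(S_{\mathfrak p})=\mathrm e_{Q'}^1(A)+\ell_{T'_{\mathfrak p'}}(S'_{\mathfrak p'})=\mathrm e_{\mathfrak m}^1(A)-\mathrm e_{\mathfrak m}^0(A)+1 .$$ -/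

import Mathlib

open Filter Polynomial

noncomputable section

namespace SallySum

/-- `q` is a reduction of `J`: `q ⊆ J` and `J ^ (n + 1) = q J ^ n` for some `n ≥ 0`. -/
def IsReduction {R : Type*} [CommRing R] (q J : Ideal R) : Prop :=
  q ≤ J ∧ ∃ n : ℕ, J ^ (n + 1) = q * J ^ n

/-- `a₁, …, a_d` is a system of parameters of the local ring `R`: `d = dim R` and the ideal
`(a₁, …, a_d)` is primary to the maximal ideal.  A parameter ideal is an ideal generated by a
system of parameters. -/
def IsSystemOfParameters {R : Type*} [CommRing R] [IsLocalRing R] {d : ℕ} (a : Fin d → R) : Prop :=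
  ringKrullDim R = d ∧ (Ideal.span (Set.range a)).radical = IsLocalRing.maximalIdeal R

section Hilbert

variable {R : Type*} [CommRing R]

/-- `e 0, …, e s`, where `s = dim R`, are the Hilbert coefficients of `R` with respect to `I`:
for all `n ≫ 0` the length of `R / I ^ (n + 1)` is finite and equal to
`∑ i ≤ s, (-1) ^ i e_i binom (n + s - i) (s - i)`.  (Beyond the index `s`, `e` is `0`.) -/
def IsHilbertCoeffs (I : Ideal R) (e : ℕ → ℤ) : Prop :=
  ∃ s : ℕ, ringKrullDim R = s ∧ (∀ i, s < i → e i = 0) ∧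
    ∀ᶠ n : ℕ in atTop, ∃ l : ℕ, Module.length R (R ⧸ I ^ (n + 1)) = l ∧
      (l : ℤ) = ∑ i ∈ Finset.range (s + 1), (-1) ^ i * e i * ((n + s - i).choose (s - i) : ℤ)

lemma coeffs_eq_zero (s : ℕ) (c : ℕ → ℤ)
    (h : ∀ᶠ n : ℕ in atTop,
      ∑ i ∈ Finset.range (s + 1), c i * ((n + s - i).choose (s - i) : ℤ) = 0) :
    ∀ i, i ≤ s → c i = 0 := by
  induction s with
  | zero =>
    obtain ⟨n, hn⟩ := h.exists
    intro i hi
    obtain rfl : i = 0 := by omega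
    simpa using hn
  | succ s ih =>
    have key : ∀ i, i ≤ s → c i = 0 := by
      apply ih
      obtain ⟨N, hN⟩ := eventually_atTop.1 h
      refine eventually_atTop.2 ⟨N + 1, fun n hn => ?_⟩
      obtain ⟨m, rfl⟩ : ∃ m, n = m + 1 := ⟨n - 1, by omega⟩
      have h1 := hN m (by omega)
      have h2 := hN (m + 1) (by omega)
      rw [Finset.sum_range_succ] at h1 h2
      have h3 : ∑ i ∈ Finset.range (s + 1), c i * ((m + 1 + s - i).choose (s - i) : ℤ) =
          ∑ i ∈ Finset.range (s + 1), c i * ((m + 1 + (s + 1) - i).choose (s + 1 - i) : ℤ) -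
          ∑ i ∈ Finset.range (s + 1), c i * ((m + (s + 1) - i).choose (s + 1 - i) : ℤ) := by
        rw [← Finset.sum_sub_distrib]
        refine Finset.sum_congr rfl fun i hi => ?_
        have hi' : i ≤ s := by simpa [Nat.lt_succ_iff] using hi
        obtain ⟨t, rfl⟩ := Nat.exists_eq_add_of_le hi'
        have e1 : m + 1 + (i + t) - i = m + t + 1 := by omega
        have e2 : i + t - i = t := by omega
        have e3 : m + 1 + (i + t + 1) - i = m + t + 1 + 1 := by omega
        have e4 : i + t + 1 - i = t + 1 := by omega
        have e5 : m + (i + t + 1) - i = m + t + 1 := by omega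
        rw [e1, e2, e3, e4, e5, Nat.choose_succ_succ (m + t + 1) t]
        push_cast
        ring
      rw [h3]
      simp only [Nat.sub_self, Nat.choose_zero_right, Nat.cast_one] at h1 h2
      linarith
    intro i hi
    rcases Nat.lt_or_ge i (s + 1) with hlt | hge
    · exact key i (by omega)
    · obtain rfl : i = s + 1 := by omega
      obtain ⟨n, hn⟩ := h.exists
      rw [Finset.sum_range_succ, Finset.sum_eq_zero] at hn
      · simpa using hn
      · intro j hj
        rw [key j (by simpa [Nat.lt_succ_iff] using hj), zero_mul]

/-- The Hilbert coefficients are uniquely determined by the Hilbert function. -/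
lemma IsHilbertCoeffs.unique {I : Ideal R} {e e' : ℕ → ℤ} (h : IsHilbertCoeffs I e)
    (h' : IsHilbertCoeffs I e') : e = e' := by
  obtain ⟨s, hs, h0, hn⟩ := h
  obtain ⟨s', hs', h0', hn'⟩ := h'
  obtain rfl : s = s' := by
    rw [hs] at hs'
    exact_mod_cast hs'
  have key := coeffs_eq_zero s (fun i => (-1) ^ i * (e i - e' i)) (by
    filter_upwards [hn, hn'] with n ⟨l, hl, hl1⟩ ⟨l', hl', hl1'⟩
    have hll : (l : ℤ) = l' := by
      rw [hl] at hl'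
      exact_mod_cast hl'
    rw [hl1, hl1'] at hll
    rw [← sub_eq_zero, ← Finset.sum_sub_distrib] at hll
    rw [← hll]
    exact Finset.sum_congr rfl fun i _ => by ring)
  funext i
  rcases Nat.lt_or_ge s i with hi | hi
  · rw [h0 i hi, h0' i hi]
  · have := key i hi
    simpa [sub_eq_zero] using this

open Classical in
/-- The `i`-th Hilbert coefficient `e_I^i(R)` of `R` with respect to `I`. -/
def hilbertCoeff (I : Ideal R) (i : ℕ) : ℤ :=
  if h : ∃ e : ℕ → ℤ, IsHilbertCoeffs I e then h.choose i else 0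

lemma IsHilbertCoeffs.hilbertCoeff_eq {I : Ideal R} {e : ℕ → ℤ} (h : IsHilbertCoeffs I e) :
    hilbertCoeff I = e := by
  have hex : ∃ e : ℕ → ℤ, IsHilbertCoeffs I e := ⟨e, h⟩
  funext i
  rw [hilbertCoeff, dif_pos hex, hex.choose_spec.unique h]

end Hilbert

section Sally

variable {R : Type*} [CommRing R]

/-- `I·ℛ(K)` as an `ℛ(Q)`-submodule of `R[t]`, where `ℛ(K) = R[Kt] ⊆ R[t]` is the Rees algebra
of `K ⊇ Q`. -/
def mulRees (Q I K : Ideal R) : Submodule (reesAlgebra Q) R[X] :=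
  (I.map (algebraMap R (reesAlgebra Q)) : Ideal (reesAlgebra Q)) •
    Submodule.span (reesAlgebra Q) (reesAlgebra K : Set R[X])

/-- For `Q ⊆ K`, the degree `n` component of `I·ℛ(K)` is `I K ^ n`. -/
lemma mem_mulRees_iff {Q I K : Ideal R} (hQ : Q ≤ K) (f : R[X]) :
    f ∈ mulRees Q I K ↔ ∀ n, f.coeff n ∈ I * K ^ n := by
  have hspan : ∀ g ∈ Submodule.span (reesAlgebra Q) (reesAlgebra K : Set R[X]),
      g ∈ reesAlgebra K := by
    intro g hg
    induction hg using Submodule.span_induction with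
    | mem x hx => exact hx
    | zero => exact zero_mem _
    | add x y _ _ hx hy => exact add_mem hx hy
    | smul c x _ hx =>
      have hc : (c : R[X]) ∈ reesAlgebra K := by
        rw [mem_reesAlgebra_iff]
        exact fun i => Ideal.pow_right_mono hQ i ((mem_reesAlgebra_iff _ _).1 c.2 i)
      exact mul_mem hc hx
  constructor
  · intro hf
    induction hf using Submodule.smul_induction_on' with
    | smul r hr g hg =>
      have hg' := hspan g hg
      have hr' : ∀ n, (r : R[X]).coeff n ∈ I * Q ^ n := by
        clear hg hg'
        rw [Ideal.map] at hr
        induction hr using Submodule.span_induction with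
        | mem x hx =>
          obtain ⟨y, hy, rfl⟩ := hx
          intro n
          change (algebraMap R R[X] y).coeff n ∈ _
          rw [Polynomial.algebraMap_eq, Polynomial.coeff_C]
          split_ifs with h
          · subst h; simpa using hy
          · exact zero_mem _
        | zero => intro n; simp
        | add x y _ _ hx hy =>
          intro n
          simpa using add_mem (hx n) (hy n)
        | smul c x _ hx =>
          intro n
          change ((c : R[X]) * (x : R[X])).coeff n ∈ _
          rw [Polynomial.coeff_mul]
          refine sum_mem fun p hp => ?_
          have h1 := (mem_reesAlgebra_iff _ _).1 c.2 p.1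
          have h2 := Ideal.mul_mem_mul h1 (hx p.2)
          rw [← Finset.HasAntidiagonal.mem_antidiagonal.1 hp]
          convert h2 using 1
          rw [pow_add]
          ring
      intro n
      change ((r : R[X]) * g).coeff n ∈ _
      rw [Polynomial.coeff_mul]
      refine sum_mem fun p hp => ?_
      have h2 := Ideal.mul_mem_mul (Ideal.mul_mono_right (Ideal.pow_right_mono hQ p.1) (hr' p.1))
        ((mem_reesAlgebra_iff _ _).1 hg' p.2)
      rw [← Finset.HasAntidiagonal.mem_antidiagonal.1 hp, pow_add, ← mul_assoc]
      exact h2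
    | add x _ y _ hx hy =>
      intro n
      simpa using add_mem (hx n) (hy n)
  · intro hf
    rw [← Polynomial.sum_monomial_eq f, Polynomial.sum]
    refine sum_mem fun n _ => ?_
    have h := hf n
    generalize f.coeff n = c at h
    induction h using Submodule.mul_induction_on' with
    | mem_mul_mem x hx y hy =>
      have h1 : (monomial n (x * y) : R[X]) =
          (algebraMap R (reesAlgebra Q) x) • (monomial n y : R[X]) := by
        change _ = (algebraMap R R[X] x) * _
        rw [Polynomial.algebraMap_eq, Polynomial.C_mul_monomial]
      rw [h1]
      refine Submodule.smul_mem_smul (Ideal.mem_map_of_mem _ hx) (Submodule.subset_span ?_)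
      exact reesAlgebra.monomial_mem.2 hy
    | add x _ y _ hx hy => rw [map_add]; exact add_mem hx hy

/-- The Sally module `S_Q(I) = I·ℛ(I) / I·ℛ(Q)` of `I` with respect to `Q ⊆ I`, a module over
`ℛ(Q)`; it is realized as the image of `I·ℛ(I)` in `R[t] / I·ℛ(Q)`. -/
def SallyModule (Q I : Ideal R) : Submodule (reesAlgebra Q) (R[X] ⧸ mulRees Q I Q) :=
  (mulRees Q I I).map (mulRees Q I Q).mkQ

/-- `ℓ_{T_p}(M_p)` for a `T`-module `M` and a prime ideal `p` of `T`. -/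
def localLength {T : Type*} [CommRing T] (p : Ideal T) [p.IsPrime] (M : Type*) [AddCommGroup M]
    [Module T M] : ℕ∞ :=
  Module.length (Localization.AtPrime p) (LocalizedModule p.primeCompl M)

/-- The extension `I T` of `I` to the Rees algebra `T = ℛ(Q)`. -/
def reesExtend (Q I : Ideal R) : Ideal (reesAlgebra Q) :=
  I.map (algebraMap R (reesAlgebra Q))

/-- `ℓ_{T_p}(S_p)`, where `S = S_Q(I)`, `T = ℛ(Q)` and `p` is a prime ideal of `T`. -/
def sallyLocalLength (Q I : Ideal R) (p : Ideal (reesAlgebra Q)) (hp : p.IsPrime) : ℕ∞ :=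
  haveI := hp
  localLength p (SallyModule Q I)

end Sally

section Setting

variable (k : Type*) {B : Type*} [Field k] [CommRing B] [Algebra k B]

/-- The `k`-subalgebra `A = k + J` of `B`. -/
def kPlus (J : Ideal B) : Subalgebra k B where
  carrier := {b | ∃ c : k, ∃ j ∈ J, b = algebraMap k B c + j}
  mul_mem' := by
    rintro _ _ ⟨c, j, hj, rfl⟩ ⟨c', j', hj', rfl⟩
    refine ⟨c * c', algebraMap k B c * j' + algebraMap k B c' * j + j * j', ?_, ?_⟩
    · exact add_mem (add_mem (J.mul_mem_left _ hj') (J.mul_mem_left _ hj)) (J.mul_mem_left _ hj')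
    · rw [map_mul]; ring
  add_mem' := by
    rintro _ _ ⟨c, j, hj, rfl⟩ ⟨c', j', hj', rfl⟩
    exact ⟨c + c', j + j', add_mem hj hj', by rw [map_add]; ring⟩
  algebraMap_mem' := fun c => ⟨c, 0, zero_mem _, by simp⟩

/-- `J` regarded as an ideal `𝔪` of `A = k + J` (note `J ⊆ A`). -/
def kPlusMax (J : Ideal B) : Ideal (kPlus k J) := J.comap (kPlus k J).val

/-- The ideal `(a₁, …, a_d)A` of `A = k + J` generated by elements `a₁, …, a_d` of `J ⊆ A`. -/
def kPlusSpan (J : Ideal B) {d : ℕ} (a : Fin d → B) : Ideal (kPlus k J) :=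
  Ideal.span {x | ∃ i, (x : B) = a i}

/-- If `J` is a proper ideal of the local ring `B`, then `A = k + J` is a local ring. -/
lemma isLocalRing_kPlus [IsLocalRing B] (J : Ideal B) (hJ : J ≠ ⊤) :
    IsLocalRing (kPlus k J) := by
  have hle := IsLocalRing.le_maximalIdeal hJ
  have hunit : ∀ x : kPlus k J, x ∉ kPlusMax k J → IsUnit x := by
    rintro ⟨x, c, j, hj, rfl⟩ hx
    have hc : c ≠ 0 := by
      rintro rfl
      exact hx (by simpa [kPlusMax] using hj)
    have hcu : IsUnit (algebraMap k B c) := (IsUnit.mk0 c hc).map _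
    have hu : IsUnit (algebraMap k B c + j) := by
      by_contra h
      have h1 : algebraMap k B c + j ∈ IsLocalRing.maximalIdeal B := h
      have h2 := sub_mem h1 (hle hj)
      rw [add_sub_cancel_right] at h2
      exact h2 hcu
    obtain ⟨u, hu⟩ := hu.exists_right_inv
    have hcc : algebraMap k B c⁻¹ * algebraMap k B c = 1 := by
      rw [← map_mul, inv_mul_cancel₀ hc, map_one]
    have hmem : u ∈ kPlus k J := by
      refine ⟨c⁻¹, -(algebraMap k B c⁻¹ * u) * j, J.mul_mem_left _ hj, ?_⟩
      linear_combination (-u) * hcc + (algebraMap k B c⁻¹) * hu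
    exact IsUnit.of_mul_eq_one (⟨u, hmem⟩ : kPlus k J) (Subtype.ext hu)
  have : Nontrivial (kPlus k J) := inferInstance
  refine IsLocalRing.of_nonunits_add fun x y hx hy => ?_
  have hx' : x ∈ kPlusMax k J := by by_contra h; exact hx (hunit x h)
  have hy' : y ∈ kPlusMax k J := by by_contra h; exact hy (hunit y h)
  intro hxy
  have h1 := Ideal.eq_top_of_isUnit_mem _ (add_mem hx' hy') hxy
  exact hJ (by
    rw [Ideal.eq_top_iff_one] at h1 ⊢
    simpa [kPlusMax] using h1)

/-- The maximal ideal of `A = k + J` is `𝔪 = J`. -/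
lemma maximalIdeal_kPlus [IsLocalRing B] (J : Ideal B) (hJ : J ≠ ⊤) [IsLocalRing (kPlus k J)] :
    IsLocalRing.maximalIdeal (kPlus k J) = kPlusMax k J := by
  refine (IsLocalRing.eq_maximalIdeal ?_).symm
  refine Ideal.isMaximal_iff.2 ⟨fun h => hJ ?_, ?_⟩
  · rw [Ideal.eq_top_iff_one]
    simpa [kPlusMax] using h
  · rintro I ⟨x, c, j, hj, rfl⟩ hI hx hxI
    have hc : c ≠ 0 := by
      rintro rfl
      exact hx (by simpa [kPlusMax] using hj)
    have hjA : j ∈ kPlus k J := ⟨0, j, hj, by simp⟩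
    have h1 : (⟨j, hjA⟩ : kPlus k J) ∈ I := hI (by simpa [kPlusMax] using hj)
    have h2 := I.mul_mem_left (algebraMap k (kPlus k J) c⁻¹) (sub_mem hxI h1)
    convert h2
    apply Subtype.ext
    change (1 : B) = algebraMap k B c⁻¹ * (algebraMap k B c + j - j)
    rw [add_sub_cancel_right, ← map_mul, inv_mul_cancel₀ hc, map_one]

end Setting

end SallySum

end

/-! The right-hand side depends on `m` alone, so it suffices to prove `e₁(Q) + ℓ(S_p) = e₁(m) -
e₀(m) + 1` for one parameter ideal `Q` that is a reduction of the maximal ideal `m` of a Noetherian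
local ring of dimension `D + 1`, and then to check that `A = k + J` is such a ring.

Both sides are read off from the growth of `ℓ(m^{n+1}/mQ^n)`, the Hilbert function of the Sally
module. Computing `ℓ(R/mQ^n)` in two ways gives `ℓ(m^{n+1}/mQ^n) = ℓ(Q^n/mQ^n) + ℓ(R/Q^n) -
ℓ(R/m^{n+1})`. The generators of `Q` are analytically independent, so `ℓ(Q^n/mQ^n)` is exactly
`binom(n+D, D)`. Comparison of growth forces `e₀(Q) = e₀(m)`, and the coefficient of `n^D/D!`
becomes `1 - e₀(m) - e₁(Q) + e₁(m)` (`coeff_identity`).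

On the other hand this coefficient is `ℓ(S_p)`. The fiber cone `T/p` is a polynomial ring over the
residue field, so `p = mT` is prime (`reesExtend_isPrime`). The Sally module is built up by cyclic
graded pieces killed by `p`. A piece isomorphic to `T/p` up to shift adds `1` to the local length
and `n^D/D!` to the growth; any other piece is killed by an element outside `p` and adds `0` and
`o(n^D)` (`hasRank_adjoinMonomial`, `hasRank_of_wellFoundedGT`).

Analytic independence rests on the bound `dim R ≤ s` when `ℓ(R/m^n) = O(n^s)`
(`ringKrullDim_le_of_relLen_le`): a nontrivial relation would make `ℓ(R/Q^n)` grow too slowly.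
Hilbert polynomials come from a Hilbert–Serre argument (`evPoly_relLen`), whose chain condition
holds because the reduction makes `⨁ m^n t^n` a finite `T`-module. -/

namespace SallySum

/-! ### Lengths of subquotients -/

section RelativeLength

variable {R M N : Type*} [CommRing R] [AddCommGroup M] [Module R M] [AddCommGroup N] [Module R N]

/-- The subquotient `W / (V ∩ W)` of a module, for submodules `V` and `W`. -/
abbrev Subquotient (V W : Submodule R M) : Type _ := W ⧸ V.submoduleOf W

/-- The inclusion of `U / V` in `W / V` for `U ≤ W`. -/
def Subquotient.incl (V : Submodule R M) {U W : Submodule R M} (h : U ≤ W) :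
    Subquotient V U →ₗ[R] Subquotient V W :=
  Submodule.mapQ _ _ (Submodule.inclusion h) (fun _ hx => hx)

/-- The projection of `W / V` onto `W / U` for `V ≤ U`. -/
def Subquotient.proj {V U : Submodule R M} (h : V ≤ U) (W : Submodule R M) :
    Subquotient V W →ₗ[R] Subquotient U W :=
  Submodule.mapQ _ _ LinearMap.id (fun _ hx => h hx)

lemma Subquotient.incl_injective (V : Submodule R M) {U W : Submodule R M} (h : U ≤ W) :
    Function.Injective (Subquotient.incl V h) := by
  rw [← LinearMap.ker_eq_bot, LinearMap.ker_eq_bot']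
  intro x
  induction x using Submodule.Quotient.induction_on with
  | H x =>
    intro hx
    exact (Submodule.Quotient.mk_eq_zero _).2
      ((Submodule.Quotient.mk_eq_zero (V.submoduleOf W) (x := Submodule.inclusion h x)).1 hx)

lemma Subquotient.proj_surjective {V U : Submodule R M} (h : V ≤ U) (W : Submodule R M) :
    Function.Surjective (Subquotient.proj h W) := by
  intro x
  induction x using Submodule.Quotient.induction_on with
  | H x => exact ⟨Submodule.Quotient.mk x, rfl⟩

lemma Subquotient.exact {V U W : Submodule R M} (h : V ≤ U) (h' : U ≤ W) :
    Function.Exact (Subquotient.incl V h') (Subquotient.proj h W) := by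
  intro x
  induction x using Submodule.Quotient.induction_on with
  | H x =>
    constructor
    · intro hx
      have hxU : (x : M) ∈ U :=
        (Submodule.Quotient.mk_eq_zero (U.submoduleOf W) (x := x)).1 hx
      exact ⟨Submodule.Quotient.mk ⟨x, hxU⟩, rfl⟩
    · rintro ⟨y, hy⟩
      induction y using Submodule.Quotient.induction_on with
      | H y =>
        rw [← hy]
        exact (Submodule.Quotient.mk_eq_zero (U.submoduleOf W)).2 y.2

/-- The subquotient `W / (V ∩ W)` is the image of `W` in `M / V`. -/
noncomputable def Subquotient.equivMap (V W : Submodule R M) :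
    Subquotient V W ≃ₗ[R] W.map V.mkQ :=
  (Submodule.quotEquivOfEq _ _ (by
    ext x
    rw [LinearMap.mem_ker, ← Subtype.coe_inj]
    change (x : M) ∈ V ↔ V.mkQ x = 0
    rw [Submodule.mkQ_apply, Submodule.Quotient.mk_eq_zero])).trans
    ((V.mkQ.submoduleMap W).quotKerEquivOfSurjective (LinearMap.submoduleMap_surjective _ _))

/-- The length of `W / (V ∩ W)`. -/
noncomputable def relLen (V W : Submodule R M) : ℕ∞ := Module.length R (Subquotient V W)

lemma relLen_eq_length {V W : Submodule R M} (g : W →ₗ[R] N) (hg : Function.Surjective g)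
    (h : ∀ w, g w = 0 ↔ (w : M) ∈ V) : relLen V W = Module.length R N := by
  have hk : V.submoduleOf W = LinearMap.ker g := by
    ext w
    exact (h w).symm
  unfold relLen Subquotient; rw [hk]
  exact (g.quotKerEquivOfSurjective hg).length_eq

lemma relLen_top (V : Submodule R M) : relLen V ⊤ = Module.length R (M ⧸ V) :=
  relLen_eq_length (V.mkQ ∘ₗ (⊤ : Submodule R M).subtype)
    (fun x => by
      obtain ⟨y, rfl⟩ := V.mkQ_surjective x
      exact ⟨⟨y, trivial⟩, rfl⟩)
    (fun w => by simp)

lemma relLen_add {V U W : Submodule R M} (h : V ≤ U) (h' : U ≤ W) :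
    relLen V U + relLen U W = relLen V W :=
  (Module.length_eq_add_of_exact _ _ (Subquotient.incl_injective V h')
    (Subquotient.proj_surjective h W) (Subquotient.exact h h')).symm

lemma relLen_le_left {V U : Submodule R M} (h : V ≤ U) (W : Submodule R M) :
    relLen U W ≤ relLen V W :=
  Module.length_le_of_surjective _ (Subquotient.proj_surjective h W)

lemma relLen_le_right (V : Submodule R M) {U W : Submodule R M} (h : U ≤ W) :
    relLen V U ≤ relLen V W :=
  Module.length_le_of_injective _ (Subquotient.incl_injective V h)

lemma relLen_eq_zero_iff {V W : Submodule R M} : relLen V W = 0 ↔ W ≤ V := by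
  rw [relLen, Module.length_eq_zero_iff, Submodule.Quotient.subsingleton_iff]
  constructor
  · intro h x hx
    have : (⟨x, hx⟩ : W) ∈ V.submoduleOf W := h ▸ trivial
    exact this
  · intro h
    exact eq_top_iff.2 fun x _ => h x.2

lemma relLen_inf (V W : Submodule R M) : relLen (V ⊓ W) W = relLen V W :=
  relLen_eq_length (V.submoduleOf W).mkQ (Submodule.mkQ_surjective _) (fun w => by
    rw [Submodule.mkQ_apply, Submodule.Quotient.mk_eq_zero]
    exact ⟨fun h => ⟨h, w.2⟩, fun h => h.1⟩)

/-- Second isomorphism theorem along `φ`. With `φ` multiplication by a ring element it carries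
lengths from one degree of a graded module to a later one. -/
lemma relLen_sup_map (V : Submodule R N) (W : Submodule R M) (φ : M →ₗ[R] N) :
    relLen V (V ⊔ W.map φ) = relLen (V.comap φ) W := by
  refine (relLen_eq_length (N := Subquotient V (V ⊔ W.map φ))
    ((V.submoduleOf _).mkQ ∘ₗ (φ.restrict (p := W) (q := V ⊔ W.map φ)
      (fun x hx => Submodule.mem_sup_right ⟨x, hx, rfl⟩))) ?_ ?_).symm
  · intro x
    obtain ⟨⟨y, hy⟩, rfl⟩ := Submodule.mkQ_surjective _ x
    obtain ⟨v, hv, _, ⟨w, hw, rfl⟩, rfl⟩ := Submodule.mem_sup.1 hy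
    refine ⟨⟨w, hw⟩, ?_⟩
    rw [LinearMap.comp_apply, ← sub_eq_zero, ← map_sub, Submodule.mkQ_apply,
      Submodule.Quotient.mk_eq_zero]
    change φ w - (v + φ w) ∈ V
    rw [sub_add_cancel_right]
    exact neg_mem hv
  · intro w
    rw [LinearMap.comp_apply, Submodule.mkQ_apply, Submodule.Quotient.mk_eq_zero]
    exact Iff.rfl

lemma relLen_sup_map_le {V : Submodule R N} {V' W : Submodule R M} {φ : M →ₗ[R] N}
    (h : V'.map φ ≤ V) : relLen V (V ⊔ W.map φ) ≤ relLen V' W := by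
  rw [relLen_sup_map]
  exact relLen_le_left (Submodule.map_le_iff_le_comap.1 h) W

end RelativeLength

end SallySum

namespace SallySum

/-! ### Lengths of ideal quotients -/

section IdealLength

variable {R : Type*} [CommRing R]

lemma map_mulLeft (a : R) (W : Ideal R) :
    Submodule.map (LinearMap.mulLeft R a) W = Ideal.span {a} * W := by
  ext x
  rw [Ideal.mem_span_singleton_mul]
  exact Iff.rfl

lemma relLen_sup_span_mul (V W : Ideal R) (a : R) :
    relLen V (V ⊔ Ideal.span {a} * W) =
      relLen (Submodule.comap (LinearMap.mulLeft R a) V) W := by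
  rw [← map_mulLeft]
  exact relLen_sup_map V W _

/-- Adjoining the products `cI` one at a time, each step is a quotient of `I/mI`. The ideal `V` has
to vary in the induction because it absorbs the products already adjoined. -/
lemma relLen_sup_span_finset_mul_le (S : Finset R) (m I V : Ideal R)
    (h : ∀ c ∈ S, Ideal.span {c} * (m * I) ≤ V) :
    relLen V (V ⊔ Ideal.span (S : Set R) * I) ≤ S.card * relLen (m * I) I := by
  classical
  induction S using Finset.induction_on generalizing V with
  | empty => simp [relLen_eq_zero_iff]
  | insert c S hc ih =>
    have h1 : V ⊔ Ideal.span ((insert c S : Finset R) : Set R) * I =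
        (V ⊔ Ideal.span {c} * I) ⊔ Ideal.span (S : Set R) * I := by
      rw [Finset.coe_insert, Ideal.span_insert, Ideal.sup_mul, sup_assoc]
    rw [h1, ← relLen_add le_sup_left le_sup_left, Finset.card_insert_of_notMem hc, add_comm,
      Nat.cast_add, Nat.cast_one, add_mul, one_mul]
    refine add_le_add (ih _ fun x hx => (h x (Finset.mem_insert_of_mem hx)).trans le_sup_left) ?_
    rw [← map_mulLeft]
    refine relLen_sup_map_le ?_
    rw [map_mulLeft]
    exact h c (Finset.mem_insert_self _ _)

lemma relLen_span_finset_mul_le (S : Finset R) (m I : Ideal R) :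
    relLen (m * (Ideal.span (S : Set R) * I)) (Ideal.span (S : Set R) * I) ≤
      S.card * relLen (m * I) I := by
  have := relLen_sup_span_finset_mul_le S m I (m * (Ideal.span (S : Set R) * I)) (by
    intro c hc
    rw [mul_left_comm]
    exact Ideal.mul_mono_right (Ideal.mul_mono_left
      ((Ideal.span_singleton_le_iff_mem _).2 (Ideal.subset_span hc))))
  rwa [sup_eq_right.2 Ideal.mul_le_right] at this

/-- Each layer `m^i I / m^{i+1} I` costs at most the number of generators of `m^i` times `ℓ(I/mI)`.
The point is that `C` does not depend on `I`, so it serves all powers `Q^j` at once. -/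
lemma relLen_pow_mul_le [IsNoetherianRing R] (m : Ideal R) (c : ℕ) :
    ∃ C : ℕ, ∀ I : Ideal R, relLen (m ^ c * I) I ≤ C * relLen (m * I) I := by
  induction c with
  | zero => exact ⟨0, fun I => by simp [relLen_eq_zero_iff]⟩
  | succ c ih =>
    obtain ⟨C, hC⟩ := ih
    obtain ⟨S, hS⟩ := (isNoetherianRing_iff_ideal_fg R).1 inferInstance (m ^ c)
    refine ⟨S.card + C, fun I => ?_⟩
    have h1 : m ^ (c + 1) * I ≤ m ^ c * I := Ideal.mul_mono_left (Ideal.pow_le_pow_right (by omega))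
    rw [← relLen_add h1 Ideal.mul_le_right, Nat.cast_add, add_mul]
    refine add_le_add ?_ (hC I)
    have h2 := relLen_span_finset_mul_le S m I
    have h3 : Ideal.span (S : Set R) = m ^ c := hS
    rwa [h3, ← mul_assoc, ← pow_succ'] at h2

variable [IsLocalRing R]

lemma relLen_maximalIdeal_top : relLen (IsLocalRing.maximalIdeal R) ⊤ = 1 := by
  rw [relLen_top, Module.length_eq_one_iff]
  exact isSimpleModule_iff_quot_maximal.2
    ⟨_, IsLocalRing.maximalIdeal.isMaximal R, ⟨LinearEquiv.refl R _⟩⟩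

lemma relLen_ne_top [IsNoetherianRing R] {I : Ideal R} {n : ℕ}
    (h : IsLocalRing.maximalIdeal R ^ n ≤ I) (W : Ideal R) : relLen I W ≠ ⊤ := by
  obtain ⟨C, hC⟩ := relLen_pow_mul_le (IsLocalRing.maximalIdeal R) n
  have h1 := hC ⊤
  rw [Ideal.mul_top, Ideal.mul_top, relLen_maximalIdeal_top, mul_one] at h1
  have h2 : relLen I W ≤ C := ((relLen_le_left h W).trans (relLen_le_right _ le_top)).trans h1
  exact ne_top_of_le_ne_top (ENat.natCast_ne_top C) h2

end IdealLength

/-! ### Dimension is bounded by the growth of `ℓ(R/m^n)` -/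

section Dimension

/-- Summing the hypothesis over `n < 2N` telescopes to `c` values of `f`, while the `N` terms with
index in `[N, 2N)` are each at least `g N`. Thus `g` grows one order more slowly than `f`. -/
lemma mul_le_of_add_le {f g : ℕ → ℕ} {c : ℕ} (hf : Monotone f) (hg : Monotone g)
    (h : ∀ n, g n + f n ≤ f (n + c)) (N : ℕ) : N * g N ≤ c * f (2 * N + c) := by
  have key : ∀ M, ∑ n ∈ Finset.range M, g n + ∑ n ∈ Finset.range c, f n ≤
      ∑ n ∈ Finset.range c, f (M + n) := by
    intro M
    induction M with
    | zero => simp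
    | succ M ih =>
      have h1 := Finset.sum_range_succ (fun n => f (M + n)) c
      have h2 := Finset.sum_range_succ' (fun n => f (M + n)) c
      have h3 : ∑ n ∈ Finset.range c, f (M + (n + 1)) = ∑ n ∈ Finset.range c, f (M + 1 + n) :=
        Finset.sum_congr rfl fun n _ => by congr 1; ring
      have h4 := h M
      rw [Finset.sum_range_succ]
      simp only [add_zero] at h2
      omega
  have h1 : N * g N ≤ ∑ n ∈ Finset.range (2 * N), g n := by
    rw [two_mul, Finset.sum_range_add]
    have : ∑ _n ∈ Finset.range N, g N ≤ ∑ n ∈ Finset.range N, g (N + n) :=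
      Finset.sum_le_sum fun n _ => hg (by omega)
    rw [Finset.sum_const, Finset.card_range, smul_eq_mul] at this
    omega
  have h2 : ∑ n ∈ Finset.range c, f (2 * N + n) ≤ c * f (2 * N + c) := by
    have : ∑ n ∈ Finset.range c, f (2 * N + n) ≤ ∑ _n ∈ Finset.range c, f (2 * N + c) :=
      Finset.sum_le_sum fun n hn => hf (by have := Finset.mem_range.1 hn; omega)
    rwa [Finset.sum_const, Finset.card_range, smul_eq_mul] at this
  have := key (2 * N)
  omega

lemma relLen_map_mk {R : Type*} [CommRing R] (P I : Ideal R) :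
    relLen (I.map (Ideal.Quotient.mk P)) ⊤ = relLen (P ⊔ I) ⊤ := by
  rw [relLen_top, relLen_top,
    ← Module.length_eq_of_surjective (S := R) (R := R ⧸ P) Ideal.Quotient.mk_surjective]
  have e := (DoubleQuot.quotQuotEquivQuotSupₐ R P I).toLinearEquiv
  exact e.length_eq

open IsLocalRing in
lemma map_mk_maximalIdeal {R : Type*} [CommRing R] [IsLocalRing R] (P : Ideal R)
    [IsLocalRing (R ⧸ P)] :
    (maximalIdeal R).map (Ideal.Quotient.mk P) = maximalIdeal (R ⧸ P) := by
  have h := Ideal.comap_isMaximal_of_surjective (Ideal.Quotient.mk P)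
    Ideal.Quotient.mk_surjective (K := maximalIdeal (R ⧸ P))
  rw [← IsLocalRing.eq_maximalIdeal h,
    Ideal.map_comap_of_surjective _ Ideal.Quotient.mk_surjective]

open IsLocalRing in
/-- If `x` is a nonzerodivisor, then `ℓ(R / (x, m ^ n)) + ℓ(R / m ^ n) ≤ ℓ(R / m ^ (n + c))`. -/
lemma exists_relLen_sup_span_add_le {R : Type*} [CommRing R] [IsNoetherianRing R] (m : Ideal R)
    {x : R} (hx : x ∈ nonZeroDivisors R) :
    ∃ c, ∀ n, relLen (Ideal.span {x} ⊔ m ^ n) ⊤ + relLen (m ^ n) ⊤ ≤ relLen (m ^ (n + c)) ⊤ := by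
  -- Artin–Rees: `xy ∈ m^{n+c}` forces `xy ∈ x m^n`, hence `y ∈ m^n` because `x` is a
  -- nonzerodivisor.
  obtain ⟨c, hc⟩ := Ideal.exists_pow_inf_eq_pow_smul (M := R) m (Ideal.span {x})
  refine ⟨c, fun n => ?_⟩
  have h1 : m ^ (n + c) ≤ m ^ (n + c) ⊔ Ideal.span {x} * ⊤ := le_sup_left
  rw [← relLen_add h1 le_top, relLen_sup_span_mul, add_comm]
  refine add_le_add (relLen_le_left ?_ _) (relLen_le_left ?_ _)
  · intro y hy
    have hy' : x * y ∈ m ^ (n + c) := hy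
    have h2 : x * y ∈ (m ^ (n + c) • ⊤ ⊓ Ideal.span {x} : Submodule R R) :=
      ⟨by rw [smul_eq_mul, Ideal.mul_top]; exact hy',
        Ideal.mul_mem_right _ _ (Ideal.mem_span_singleton_self x)⟩
    rw [hc (n + c) (by omega), Nat.add_sub_cancel] at h2
    have h3 : x * y ∈ Ideal.span {x} * m ^ n := by
      have : (m ^ n • (m ^ c • ⊤ ⊓ Ideal.span {x}) : Submodule R R) ≤ m ^ n * Ideal.span {x} :=
        Submodule.smul_mono le_rfl inf_le_right
      rw [mul_comm]
      exact this h2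
    obtain ⟨z, hz, hzy⟩ := Ideal.mem_span_singleton_mul.1 h3
    have : z = y := by
      have h0 : (z - y) * x = 0 := by linear_combination hzy
      exact sub_eq_zero.1 ((mem_nonZeroDivisors_iff.1 hx).2 _ h0)
    exact this ▸ hz
  · rw [Ideal.mul_top, sup_comm]
    exact sup_le_sup_left (Ideal.pow_le_pow_right (by omega)) _

/-- A chain of primes already lives in the quotient by its smallest member. This reduces dimension
bounds to domains, where every nonzero element is regular. -/
lemma ringKrullDim_le_of_forall_quotient {R : Type*} [CommRing R] {s : ℕ}
    (h : ∀ P : Ideal R, P.IsPrime → ringKrullDim (R ⧸ P) ≤ s) : ringKrullDim R ≤ s := by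
  refine iSup_le fun p => ?_
  refine le_trans ?_ (h p.head.asIdeal p.head.2)
  rw [ringKrullDim_quotient]
  exact le_iSup (fun q : LTSeries (PrimeSpectrum.zeroLocus (p.head.asIdeal : Set R)) =>
    (q.length : WithBot ℕ∞)) ⟨p.length, fun i => ⟨p i, p.head_le i⟩, fun i => p.step i⟩

open IsLocalRing in
lemma exists_relLen_quotient_le {R : Type*} [CommRing R] [IsNoetherianRing R] [IsLocalRing R]
    {x : R} (hx : x ∈ nonZeroDivisors R) (s C : ℕ)
    (h : ∀ n, relLen (maximalIdeal R ^ n) ⊤ ≤ (C * (n + 1) ^ s : ℕ)) :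
    ∃ c C' : ℕ, ∀ n g : ℕ, relLen (Ideal.span {x} ⊔ maximalIdeal R ^ n) ⊤ = g →
      n * g ≤ C' * (2 * n + c) ^ s := by
  obtain ⟨c, hc⟩ := exists_relLen_sup_span_add_le (maximalIdeal R) hx
  have hf (n : ℕ) : relLen (maximalIdeal R ^ n) ⊤ ≠ ⊤ := relLen_ne_top le_rfl _
  have hg (n : ℕ) : relLen (Ideal.span {x} ⊔ maximalIdeal R ^ n) ⊤ ≠ ⊤ :=
    relLen_ne_top le_sup_right _
  -- The growth hypothesis at exponent `2n + c` involves `(2n + c + 1)^s`, whence `c + 1`.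
  refine ⟨c + 1, c * C, fun n g hn => ?_⟩
  have key := mul_le_of_add_le (f := fun n => (relLen (maximalIdeal R ^ n) ⊤).toNat)
    (g := fun n => (relLen (Ideal.span {x} ⊔ maximalIdeal R ^ n) ⊤).toNat) (c := c)
    (fun i j hij => ENat.toNat_le_toNat (relLen_le_left (Ideal.pow_le_pow_right hij) _) (hf j))
    (fun i j hij => ENat.toNat_le_toNat
      (relLen_le_left (sup_le_sup_left (Ideal.pow_le_pow_right hij) _) _) (hg j))
    (fun i => by
      rw [← ENat.toNat_add (hg i) (hf i)]
      exact ENat.toNat_le_toNat (hc i) (hf _)) n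
  simp only [hn, ENat.toNat_natCast] at key
  refine key.trans ?_
  rw [mul_assoc]
  refine Nat.mul_le_mul_left _ ?_
  exact ENat.toNat_le_of_le_natCast (h (2 * n + c))

open IsLocalRing in
/-- If `ℓ(R / m ^ n) = O(n ^ s)`, then `dim R ≤ s`. -/
theorem ringKrullDim_le_of_relLen_le (s : ℕ) : ∀ (R : Type*) [CommRing R] [IsNoetherianRing R]
    [IsLocalRing R] (C : ℕ) (_ : ∀ n, relLen (maximalIdeal R ^ n) ⊤ ≤ (C * (n + 1) ^ s : ℕ)),
    ringKrullDim R ≤ s := by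
  have quot : ∀ (R : Type _) [CommRing R] [IsLocalRing R] (P : Ideal R) [IsLocalRing (R ⧸ P)]
      (n : ℕ), relLen (maximalIdeal (R ⧸ P) ^ n) ⊤ = relLen (P ⊔ maximalIdeal R ^ n) ⊤ := by
    intro R _ _ P _ n
    rw [← map_mk_maximalIdeal, ← Ideal.map_pow, relLen_map_mk]
  have red : ∀ (R : Type _) [CommRing R] [IsNoetherianRing R] [IsLocalRing R] (C s : ℕ)
      (_ : ∀ n, relLen (maximalIdeal R ^ n) ⊤ ≤ (C * (n + 1) ^ s : ℕ)) (P : Ideal R)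
      [P.IsPrime] [IsLocalRing (R ⧸ P)] (n : ℕ),
      relLen (maximalIdeal (R ⧸ P) ^ n) ⊤ ≤ (C * (n + 1) ^ s : ℕ) := by
    intro R _ _ _ C s h P _ _ n
    rw [quot]
    exact (relLen_le_left le_sup_right _).trans (h n)
  induction s with
  | zero =>
    intro R _ _ _ C h
    refine ringKrullDim_le_of_forall_quotient fun P hP => ?_
    have : IsLocalRing (R ⧸ P) := .of_surjective' _ Ideal.Quotient.mk_surjective
    have h := red R C 0 h P
    by_cases hm : maximalIdeal (R ⧸ P) = ⊥
    · rw [ringKrullDim_eq_zero_of_isField (IsLocalRing.isField_iff_maximalIdeal_eq.2 hm)]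
      rfl
    · obtain ⟨x, hx, hx0⟩ := Submodule.exists_mem_ne_zero_of_ne_bot hm
      obtain ⟨c, C', hC⟩ := exists_relLen_quotient_le (mem_nonZeroDivisors_of_ne_zero hx0) 0 C h
      -- For `s = 0` the bound reads `n * g ≤ C'`; taking `n = C' + 1` contradicts `g ≥ 1`, which
      -- holds because `x` is a nonunit.
      obtain ⟨g, hg⟩ := ENat.ne_top_iff_exists.1 (relLen_ne_top
        (le_sup_right : maximalIdeal (R ⧸ P) ^ (C' + 1) ≤ Ideal.span {x} ⊔ _) ⊤)
      have h1 := hC (C' + 1) g hg.symm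
      have h2 : g ≠ 0 := by
        rintro rfl
        have h3 := relLen_eq_zero_iff.1 hg.symm
        have h4 : Ideal.span {x} ⊔ maximalIdeal (R ⧸ P) ^ (C' + 1) ≤ maximalIdeal (R ⧸ P) :=
          sup_le ((Ideal.span_singleton_le_iff_mem _).2 hx) (Ideal.pow_le_self (by omega))
        exact (maximalIdeal.isMaximal (R ⧸ P)).ne_top (top_le_iff.1 (h3.trans h4))
      have h3 : (C' + 1) * 1 ≤ (C' + 1) * g := Nat.mul_le_mul_left _ (by omega)
      simp only [pow_zero] at h1
      omega
  | succ s ih =>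
    intro R _ _ _ C h
    refine ringKrullDim_le_of_forall_quotient fun P hP => ?_
    have : IsLocalRing (R ⧸ P) := .of_surjective' _ Ideal.Quotient.mk_surjective
    have h := red R C (s + 1) h P
    by_cases hm : maximalIdeal (R ⧸ P) = ⊥
    · rw [ringKrullDim_eq_zero_of_isField (IsLocalRing.isField_iff_maximalIdeal_eq.2 hm)]
      exact_mod_cast Nat.zero_le _
    · obtain ⟨x, hx, hx0⟩ := Submodule.exists_mem_ne_zero_of_ne_bot hm
      have hx1 := mem_nonZeroDivisors_of_ne_zero hx0
      obtain ⟨c, C', hC⟩ := exists_relLen_quotient_le hx1 (s + 1) C h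
      have hnt : Nontrivial ((R ⧸ P) ⧸ Ideal.span {x}) :=
        Ideal.Quotient.nontrivial_iff.2 fun h => (Ideal.span_singleton_eq_top.1 h |> hx)
      have : IsLocalRing ((R ⧸ P) ⧸ Ideal.span {x}) :=
        .of_surjective' _ Ideal.Quotient.mk_surjective
      -- For `n ≥ 1` one has `2n + c ≤ (c + 2)n`, so one factor `n` cancels and the growth exponent
      -- drops to `s`. The case `n = 0` is apart, the quotient being zero there.
      have h1 := ih ((R ⧸ P) ⧸ Ideal.span {x}) (C' * (c + 2) ^ (s + 1)) (by
        intro n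
        rw [quot]
        obtain ⟨g, hg⟩ := ENat.ne_top_iff_exists.1 (relLen_ne_top
          (le_sup_right : maximalIdeal (R ⧸ P) ^ n ≤ Ideal.span {x} ⊔ _) ⊤)
        rw [← hg, Nat.cast_le]
        rcases Nat.eq_zero_or_pos n with rfl | hn
        · have : relLen (Ideal.span {x} ⊔ maximalIdeal (R ⧸ P) ^ 0) ⊤ = 0 := by
            rw [relLen_eq_zero_iff]; simp
          rw [this] at hg
          have : g = 0 := by exact_mod_cast hg
          omega
        · have h2 := hC n g hg.symm
          have h3 : (2 * n + c) ^ (s + 1) ≤ ((c + 2) * n) ^ (s + 1) :=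
            Nat.pow_le_pow_left (by nlinarith) _
          have h4 : n * g ≤ n * (C' * (c + 2) ^ (s + 1) * n ^ s) := by
            calc n * g ≤ C' * ((c + 2) * n) ^ (s + 1) := h2.trans (Nat.mul_le_mul_left _ h3)
              _ = _ := by rw [mul_pow]; ring
          refine (Nat.le_of_mul_le_mul_left h4 hn).trans (Nat.mul_le_mul_left _ ?_)
          exact Nat.pow_le_pow_left (by omega) _)
      rw [← ringKrullDim_quotient_span_singleton_succ_eq_ringKrullDim_of_mem_nonZeroDivisors hx1 hx]
      push_cast
      exact add_le_add_left h1 1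

end Dimension

end SallySum

namespace SallySum

/-! ### Analytic independence and the fiber cone -/

section FiberCone

open IsLocalRing MvPolynomial

lemma relLen_map {R M N : Type*} [CommRing R] [AddCommGroup M] [Module R M] [AddCommGroup N]
    [Module R N] (V : Submodule R N) (W : Submodule R M) (φ : M →ₗ[R] N) :
    relLen V (W.map φ) = relLen (V.comap φ) W := by
  rw [← relLen_sup_map]
  have := relLen_sup_map V (W.map φ) LinearMap.id
  rw [Submodule.map_id, Submodule.comap_id] at this
  exact this.symm

lemma relLen_pow_top {R : Type*} [CommRing R] (I : Ideal R) (n : ℕ) :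
    relLen (I ^ n) ⊤ = ∑ j ∈ Finset.range n, relLen (I ^ (j + 1)) (I ^ j) := by
  induction n with
  | zero => simp [relLen_eq_zero_iff]
  | succ n ih =>
    rw [Finset.sum_range_succ, ← ih, add_comm (relLen (I ^ n) ⊤),
      relLen_add (Ideal.pow_le_pow_right (by omega)) le_top]

variable (R : Type*) [CommRing R] [IsLocalRing R]

/-- The polynomials all of whose coefficients are nonunits. -/
noncomputable def nonunitPoly (σ : Type*) : Ideal (MvPolynomial σ R) :=
  RingHom.ker (MvPolynomial.map (σ := σ) (residue R))

variable {R}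

lemma mem_nonunitPoly {σ : Type*} {F : MvPolynomial σ R} :
    F ∈ nonunitPoly R σ ↔ ∀ e, F.coeff e ∈ maximalIdeal R := by
  rw [nonunitPoly, RingHom.mem_ker, MvPolynomial.ext_iff]
  simp only [MvPolynomial.coeff_map, MvPolynomial.coeff_zero, residue_eq_zero_iff]

instance nonunitPoly_isPrime (σ : Type*) : (nonunitPoly R σ).IsPrime :=
  RingHom.ker_isPrime _

/-- `nonunitPoly` as an `R`-submodule. -/
noncomputable abbrev nonunitPolySubmodule (R : Type*) [CommRing R] [IsLocalRing R] (σ : Type*) :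
    Submodule R (MvPolynomial σ R) :=
  (nonunitPoly R σ).restrictScalars R

lemma choose_le_succ_pow (D j : ℕ) : (j + D).choose D ≤ (j + 1) ^ D := by
  induction D with
  | zero => simp
  | succ D ih =>
    have h1 : (j + D + 1) * (j + D).choose D = (j + D + 1).choose (D + 1) * (D + 1) :=
      Nat.add_one_mul_choose_eq _ _
    have h2 : j + D + 1 ≤ (j + 1) * (D + 1) := by nlinarith
    have h3 := Nat.mul_le_mul h2 ih
    rw [h1] at h3
    have h4 : (j + D + 1).choose (D + 1) * (D + 1) ≤ (j + 1) ^ (D + 1) * (D + 1) := by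
      refine h3.trans (le_of_eq ?_)
      ring
    exact Nat.le_of_mul_le_mul_right h4 (Nat.succ_pos D)

lemma relLen_nonunitPoly (D j : ℕ) :
    relLen (nonunitPolySubmodule R (Fin (D + 1))) (homogeneousSubmodule (Fin (D + 1)) R j) =
      ((j + D).choose D : ℕ) := by
  classical
  let s : Finset (Fin (D + 1) →₀ ℕ) := Finset.finsuppAntidiag Finset.univ j
  have hs : ∀ e : Fin (D + 1) →₀ ℕ, e ∈ s ↔ e.degree = j := by
    intro e
    rw [Finset.mem_finsuppAntidiag, Finsupp.degree_eq_sum]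
    simp
  let g : MvPolynomial (Fin (D + 1)) R →ₗ[R] (s → ResidueField R) :=
    LinearMap.pi fun e => (Algebra.linearMap R (ResidueField R)) ∘ₗ (MvPolynomial.lcoeff R e.1)
  have hgapp : ∀ F e, g F e = residue R (F.coeff e.1) := fun F e => rfl
  rw [relLen_eq_length (g ∘ₗ (homogeneousSubmodule (Fin (D + 1)) R j).subtype)]
  · rw [Module.length_pi, ENat.card_eq_coe_fintype_card, Fintype.card_coe]
    have h1 : Module.length R (ResidueField R) = 1 := by
      rw [Module.length_eq_of_surjective (R := ResidueField R) residue_surjective]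
      exact Module.length_eq_one _ _
    rw [h1, mul_one, Finset.card_finsuppAntidiag_nat_eq_choose]
    have h2 : (Finset.univ : Finset (Fin (D + 1))).card + j - 1 = j + D := by
      simp; omega
    rw [h2, Nat.choose_symm_add]
  · intro v
    choose w hw using fun e => residue_surjective (R := R) (v e)
    refine ⟨⟨∑ e : s, MvPolynomial.monomial e.1 (w e), ?_⟩, ?_⟩
    · exact sum_mem fun e _ => isHomogeneous_monomial _ ((hs _).1 e.2)
    · funext e
      rw [LinearMap.comp_apply, hgapp, ← hw e]
      congr 1
      simp only [Submodule.subtype_apply, MvPolynomial.coeff_sum, MvPolynomial.coeff_monomial]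
      rw [Finset.sum_eq_single e]
      · simp
      · intro b _ hb
        rw [if_neg (fun h => hb (Subtype.ext h))]
      · simp
  · rintro ⟨F, hF⟩
    rw [Submodule.restrictScalars_mem, mem_nonunitPoly]
    constructor
    · intro h e
      by_cases he : e.degree = j
      · rw [← residue_eq_zero_iff]
        exact congr_fun h ⟨e, (hs e).2 he⟩
      · rw [((mem_homogeneousSubmodule _ _).1 hF).coeff_eq_zero he]
        exact zero_mem _
    · intro h
      funext e
      exact (residue_eq_zero_iff _).2 (h e.1)

variable {D : ℕ} (α : Fin (D + 1) → R)

/-- The forms of degree `j` that vanish in the fiber cone at `α`. -/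
noncomputable def fiberRelations (j : ℕ) : Submodule R (MvPolynomial (Fin (D + 1)) R) :=
  Submodule.comap (MvPolynomial.aeval α).toLinearMap
      (maximalIdeal R * Ideal.span (Set.range α) ^ j) ⊓
    homogeneousSubmodule (Fin (D + 1)) R j

lemma relLen_fiber (j : ℕ) :
    relLen (maximalIdeal R * Ideal.span (Set.range α) ^ j) (Ideal.span (Set.range α) ^ j) =
      relLen (fiberRelations α j) (homogeneousSubmodule (Fin (D + 1)) R j) := by
  rw [fiberRelations, relLen_inf, ← relLen_map, ← Ideal.span_pow_eq_map_homogeneousSubmodule]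

lemma aeval_mem_of_mem_nonunitPoly {F : MvPolynomial (Fin (D + 1)) R} {j : ℕ}
    (hF : F ∈ nonunitPoly R _) (hj : F.IsHomogeneous j) :
    MvPolynomial.aeval α F ∈ maximalIdeal R * Ideal.span (Set.range α) ^ j := by
  rw [F.as_sum, map_sum]
  refine sum_mem fun e he => ?_
  rw [← mul_one (MvPolynomial.coeff e F), ← smul_eq_mul (MvPolynomial.coeff e F) 1,
    ← MvPolynomial.smul_monomial, map_smul, smul_eq_mul]
  refine Ideal.mul_mem_mul (mem_nonunitPoly.1 hF e) ?_
  rw [Ideal.span_pow_eq_map_homogeneousSubmodule]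
  refine ⟨_, isHomogeneous_monomial _ ?_, rfl⟩
  by_contra h
  exact (mem_support_iff.1 he) (hj.coeff_eq_zero h)

lemma nonunitPoly_inf_le (j : ℕ) :
    nonunitPolySubmodule R (Fin (D + 1)) ⊓ homogeneousSubmodule (Fin (D + 1)) R j ≤
      fiberRelations α j :=
  fun _ hF => ⟨aeval_mem_of_mem_nonunitPoly α hF.1 hF.2, hF.2⟩

lemma relLen_fiber_le (j : ℕ) :
    relLen (maximalIdeal R * Ideal.span (Set.range α) ^ j) (Ideal.span (Set.range α) ^ j) ≤
      ((j + D).choose D : ℕ) := by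
  rw [relLen_fiber, ← relLen_nonunitPoly (R := R), ← relLen_inf (nonunitPolySubmodule R _)]
  exact relLen_le_left (nonunitPoly_inf_le α j) _

/-- Since `nonunitPoly` is prime, multiplication by `F` stays injective modulo the maximal ideal.
The multiples of `F` by forms of degree `j` therefore supply `binom(j+D, D)` independent relations
in degree `s + j`. -/
lemma relLen_fiber_add_le {F : MvPolynomial (Fin (D + 1)) R} {s : ℕ}
    (hF : F ∈ fiberRelations α s) (hF' : F ∉ nonunitPoly R _) (j : ℕ) :
    relLen (maximalIdeal R * Ideal.span (Set.range α) ^ (s + j))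
      (Ideal.span (Set.range α) ^ (s + j)) + ((j + D).choose D : ℕ) ≤
      ((s + j + D).choose D : ℕ) := by
  set P := nonunitPolySubmodule R (Fin (D + 1))
  set H := homogeneousSubmodule (Fin (D + 1)) R
  rw [relLen_fiber, ← relLen_nonunitPoly (R := R) D (s + j), ← relLen_inf P (H (s + j)),
    ← relLen_add (nonunitPoly_inf_le α (s + j)) inf_le_right, add_comm]
  refine add_le_add_left ?_ _
  let φ := LinearMap.mulLeft R F
  have h1 : (P ⊓ H (s + j)) ⊔ (H j).map φ ≤ fiberRelations α (s + j) := by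
    refine sup_le (nonunitPoly_inf_le α (s + j)) ?_
    rintro _ ⟨G, hG, rfl⟩
    have hF1 : MvPolynomial.aeval α F ∈ maximalIdeal R * Ideal.span (Set.range α) ^ s := hF.1
    refine ⟨?_, IsHomogeneous.mul hF.2 hG⟩
    change MvPolynomial.aeval α (F * G) ∈
      maximalIdeal R * Ideal.span (Set.range α) ^ (s + j)
    rw [map_mul, pow_add, ← mul_assoc]
    refine Ideal.mul_mem_mul hF1 ?_
    rw [Ideal.span_pow_eq_map_homogeneousSubmodule]
    exact ⟨G, hG, rfl⟩
  refine le_trans ?_ (relLen_le_right _ h1)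
  rw [relLen_sup_map, ← relLen_nonunitPoly (R := R) D j,
    ← relLen_inf ((P ⊓ H (s + j)).comap φ)]
  refine relLen_le_left ?_ _
  intro G hG
  have hFG : F * G ∈ nonunitPoly R (Fin (D + 1)) := hG.1.1
  exact ((nonunitPoly_isPrime _).mem_or_mem hFG).resolve_left hF'

/-- The sum of `N(s+j) - N(j)` telescopes, leaving only `s` values of `N`. With `N` of degree `D`,
the partial sums of `h` have order `n^D` instead of `n^{D+1}`. -/
lemma sum_le_of_add_le {h N : ℕ → ℕ} (s : ℕ) (h1 : ∀ j, h j ≤ N j) (hN : Monotone N)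
    (h2 : ∀ j, h (s + j) + N j ≤ N (s + j)) (n : ℕ) :
    ∑ j ∈ Finset.range n, h j ≤ s * N (s + n) := by
  have key : ∑ j ∈ Finset.range (s + n), h j + ∑ j ∈ Finset.range n, N j ≤
      ∑ j ∈ Finset.range (s + n), N j := by
    induction n with
    | zero => simpa using Finset.sum_le_sum fun j _ => h1 j
    | succ n ih =>
      rw [← add_assoc, Finset.sum_range_succ, Finset.sum_range_succ, Finset.sum_range_succ]
      have := h2 n
      omega
  have h3 : ∑ j ∈ Finset.range n, h j ≤ ∑ j ∈ Finset.range (s + n), h j :=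
    Finset.sum_le_sum_of_subset (Finset.range_mono (by omega))
  have h4 : ∑ j ∈ Finset.range (s + n), N j =
      ∑ j ∈ Finset.range n, N j + ∑ i ∈ Finset.range s, N (n + i) := by
    rw [add_comm, Finset.sum_range_add]
  have h5 : ∑ i ∈ Finset.range s, N (n + i) ≤ ∑ _i ∈ Finset.range s, N (s + n) :=
    Finset.sum_le_sum fun i hi => hN (by have := Finset.mem_range.1 hi; omega)
  rw [Finset.sum_const, Finset.card_range, smul_eq_mul] at h5
  omega

variable [IsNoetherianRing R]

/-- Analytic independence: if `dim R = D + 1` and `α₀, …, α_D` generate an ideal primary to the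
maximal ideal `m`, then a form of degree `j` whose value at `α` lies in `m (α) ^ j` has all its
coefficients in `m`. -/
theorem fiberRelations_le_nonunitPoly (hdim : ¬ ringKrullDim R ≤ D)
    (hQ : Ideal.span (Set.range α) ≤ maximalIdeal R) {c : ℕ}
    (hc : maximalIdeal R ^ c ≤ Ideal.span (Set.range α)) (j : ℕ) :
    fiberRelations α j ≤ nonunitPolySubmodule R _ := by
  intro F hF
  by_contra hF'
  apply hdim
  set Q := Ideal.span (Set.range α)
  obtain ⟨C, hC⟩ := relLen_pow_mul_le (maximalIdeal R) c
  have hle := relLen_fiber_le α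
  have hne : ∀ j, relLen (maximalIdeal R * Q ^ j) (Q ^ j) ≠ ⊤ := fun j =>
    ne_top_of_le_ne_top (ENat.natCast_ne_top _) (hle j)
  choose h hh using fun j => ENat.ne_top_iff_exists.1 (hne j)
  have key := sum_le_of_add_le (h := h) (N := fun j => (j + D).choose D) j
    (fun i => by have := hle i; rw [← hh] at this; exact_mod_cast this)
    (fun a b hab => Nat.choose_le_choose _ (by omega))
    (fun i => by
      have := relLen_fiber_add_le α hF hF' i
      rw [← hh] at this
      exact_mod_cast this)
  refine ringKrullDim_le_of_relLen_le D R (C * (j * (j + 1) ^ D)) fun n => ?_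
  -- As `m^c Q^i ⊆ Q^{i+1}`, each `ℓ(Q^i/Q^{i+1})` is at most `C` times the fiber length `h i`. A
  -- relation with a unit coefficient then makes `ℓ(R/m^n) = O(n^D)`, against `dim R > D`.
  calc relLen (maximalIdeal R ^ n) ⊤ ≤ relLen (Q ^ n) ⊤ := relLen_le_left (Ideal.pow_right_mono hQ n) _
    _ = ∑ i ∈ Finset.range n, relLen (Q ^ (i + 1)) (Q ^ i) := relLen_pow_top Q n
    _ ≤ ∑ i ∈ Finset.range n, ((C * h i : ℕ) : ℕ∞) := by
      refine Finset.sum_le_sum fun i _ => ?_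
      rw [Nat.cast_mul, hh]
      refine le_trans (relLen_le_left ?_ _) (hC (Q ^ i))
      rw [pow_succ']
      exact Ideal.mul_mono_left hc
    _ = (C * ∑ i ∈ Finset.range n, h i : ℕ) := by
      rw [Finset.mul_sum, Nat.cast_sum]
    _ ≤ (C * (j * (j + 1) ^ D) * (n + 1) ^ D : ℕ) := by
      rw [Nat.cast_le, mul_assoc]
      refine Nat.mul_le_mul_left _ ((key n).trans ?_)
      rw [mul_assoc, ← mul_pow]
      refine Nat.mul_le_mul_left _ ((choose_le_succ_pow _ _).trans (Nat.pow_le_pow_left ?_ _))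
      nlinarith

lemma relLen_fiber_eq (hdim : ¬ ringKrullDim R ≤ D)
    (hQ : Ideal.span (Set.range α) ≤ maximalIdeal R) {c : ℕ}
    (hc : maximalIdeal R ^ c ≤ Ideal.span (Set.range α)) (j : ℕ) :
    relLen (maximalIdeal R * Ideal.span (Set.range α) ^ j) (Ideal.span (Set.range α) ^ j) =
      ((j + D).choose D : ℕ) := by
  refine le_antisymm (relLen_fiber_le α j) ?_
  rw [relLen_fiber, ← relLen_nonunitPoly (R := R)]
  exact relLen_le_left (fiberRelations_le_nonunitPoly α hdim hQ hc j) _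

end FiberCone

end SallySum

namespace SallySum

/-! ### The prime ideal `mT` of the Rees algebra -/

section ReesPrime

open IsLocalRing

lemma mem_reesExtend_iff {R : Type*} [CommRing R] {Q I : Ideal R} (f : reesAlgebra Q) :
    f ∈ reesExtend Q I ↔ ∀ n, (f : R[X]).coeff n ∈ I * Q ^ n := by
  constructor
  · intro hf
    rw [reesExtend, Ideal.map] at hf
    induction hf using Submodule.span_induction with
    | mem x hx =>
      obtain ⟨y, hy, rfl⟩ := hx
      intro n
      change (algebraMap R R[X] y).coeff n ∈ _
      rw [Polynomial.algebraMap_eq, Polynomial.coeff_C]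
      split_ifs with h
      · subst h; simpa using hy
      · exact zero_mem _
    | zero => intro n; simp
    | add x y _ _ hx hy => exact fun n => by simpa using add_mem (hx n) (hy n)
    | smul c x _ hx =>
      intro n
      change ((c : R[X]) * (x : R[X])).coeff n ∈ _
      rw [Polynomial.coeff_mul]
      refine sum_mem fun p hp => ?_
      have h2 := Ideal.mul_mem_mul ((mem_reesAlgebra_iff _ _).1 c.2 p.1) (hx p.2)
      rw [← Finset.HasAntidiagonal.mem_antidiagonal.1 hp]
      convert h2 using 1
      rw [pow_add]
      ring
  · intro hf
    have hmon : ∀ n (c : R) (hc : c ∈ I * Q ^ n), (⟨monomial n c, reesAlgebra.monomial_mem.2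
        (Ideal.mul_le_right hc)⟩ : reesAlgebra Q) ∈ reesExtend Q I := by
      intro n c hc
      induction hc using Submodule.mul_induction_on' with
      | mem_mul_mem x hx y hy =>
        have : (⟨monomial n (x * y), reesAlgebra.monomial_mem.2
            (Ideal.mul_le_right (Ideal.mul_mem_mul hx hy))⟩ : reesAlgebra Q) =
            algebraMap R _ x * ⟨monomial n y, reesAlgebra.monomial_mem.2 hy⟩ := by
          apply Subtype.ext
          change monomial n (x * y) = (algebraMap R R[X] x) * monomial n y
          rw [Polynomial.algebraMap_eq, Polynomial.C_mul_monomial]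
        rw [this]
        exact Ideal.mul_mem_right _ _ (Ideal.mem_map_of_mem _ hx)
      | add x hx y hy h1 h2 =>
        convert add_mem h1 h2 using 1
        apply Subtype.ext
        simp
    have : f = ∑ n ∈ (f : R[X]).support, (⟨monomial n ((f : R[X]).coeff n),
        reesAlgebra.monomial_mem.2 ((mem_reesAlgebra_iff _ _).1 f.2 n)⟩ : reesAlgebra Q) := by
      apply Subtype.ext
      rw [AddSubmonoidClass.coe_finsetSum]
      exact (f : R[X]).as_sum_support
    rw [this]
    exact sum_mem fun n _ => hmon n _ (hf n)

variable {R : Type*} [CommRing R] {D : ℕ} (α : Fin (D + 1) → R)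

/-- The presentation `R[X₀, …, X_D] → ℛ(Q)`, `Xᵢ ↦ αᵢ t`, of the Rees algebra of `Q = (α)`. -/
noncomputable def reesPresentation :
    MvPolynomial (Fin (D + 1)) R →ₐ[R] reesAlgebra (Ideal.span (Set.range α)) :=
  MvPolynomial.aeval fun i => ⟨monomial 1 (α i), reesAlgebra.monomial_mem.2
    (by rw [pow_one]; exact Ideal.subset_span ⟨i, rfl⟩)⟩

lemma reesPresentation_of_isHomogeneous {F : MvPolynomial (Fin (D + 1)) R} {n : ℕ}
    (hF : F.IsHomogeneous n) :
    (reesPresentation α F : R[X]) = monomial n (MvPolynomial.aeval α F) := by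
  have h1 : (reesPresentation α F : R[X]) =
      MvPolynomial.aeval (fun i => (monomial 1 (α i) : R[X])) F := by
    exact DFunLike.congr_fun
      (MvPolynomial.comp_aeval _ (reesAlgebra (Ideal.span (Set.range α))).val) F
  rw [h1]
  conv_lhs => rw [F.as_sum]
  conv_rhs => rw [F.as_sum]
  rw [map_sum, map_sum, map_sum]
  refine Finset.sum_congr rfl fun e he => ?_
  have hdeg : e.degree = n := by
    by_contra h
    exact (MvPolynomial.mem_support_iff.1 he) (hF.coeff_eq_zero h)
  rw [MvPolynomial.aeval_monomial, MvPolynomial.aeval_monomial, Finsupp.prod_fintype _ _ (by simp),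
    Finsupp.prod_fintype _ _ (by simp)]
  have h2 : ∏ i, (monomial 1 (α i) : R[X]) ^ e i = monomial n (∏ i, α i ^ e i) := by
    rw [← hdeg, Finsupp.degree_eq_sum]
    simp only [← C_mul_X_pow_eq_monomial, mul_pow, Finset.prod_mul_distrib, pow_one,
      Finset.prod_pow_eq_pow_sum, map_prod, map_pow]
  rw [h2, Polynomial.algebraMap_eq, Polynomial.C_mul_monomial]
  rfl

lemma coeff_reesPresentation (F : MvPolynomial (Fin (D + 1)) R) (n : ℕ) :
    (reesPresentation α F : R[X]).coeff n =
      MvPolynomial.aeval α (MvPolynomial.homogeneousComponent n F) := by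
  conv_lhs => rw [← MvPolynomial.sum_homogeneousComponent F]
  rw [map_sum, AddSubmonoidClass.coe_finsetSum, finsetSum_coeff]
  have : ∀ i, (reesPresentation α (MvPolynomial.homogeneousComponent i F) : R[X]).coeff n =
      if i = n then MvPolynomial.aeval α (MvPolynomial.homogeneousComponent n F) else 0 := by
    intro i
    rw [reesPresentation_of_isHomogeneous α (MvPolynomial.homogeneousComponent_isHomogeneous i F),
      coeff_monomial]
    split_ifs with h
    · rw [h]
    · rfl
  rw [Finset.sum_congr rfl fun i _ => this i, Finset.sum_ite_eq']
  split_ifs with h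
  · rfl
  · rw [MvPolynomial.homogeneousComponent_eq_zero n F (by
      simpa [Nat.lt_succ_iff] using h), map_zero]

lemma reesPresentation_surjective : Function.Surjective (reesPresentation α) := by
  intro f
  choose F hF hF' using fun n => (Ideal.mem_span_pow_iff_exists_isHomogeneous α _).1
    ((mem_reesAlgebra_iff _ _).1 f.2 n)
  refine ⟨∑ n ∈ (f : R[X]).support, F n, Subtype.ext ?_⟩
  rw [map_sum, AddSubmonoidClass.coe_finsetSum]
  conv_rhs => rw [(f : R[X]).as_sum_support]
  refine Finset.sum_congr rfl fun n _ => ?_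
  rw [reesPresentation_of_isHomogeneous α (hF n), ← hF' n]
  rfl

variable [IsLocalRing R] [IsNoetherianRing R]

/-- Membership is tested degree by degree, where it is analytic independence. Consequently `T/mT` is
a polynomial ring over the residue field, and `mT` is prime. -/
lemma comap_reesExtend (hdim : ¬ ringKrullDim R ≤ D)
    (hQ : Ideal.span (Set.range α) ≤ maximalIdeal R) {c : ℕ}
    (hc : maximalIdeal R ^ c ≤ Ideal.span (Set.range α)) :
    (reesExtend (Ideal.span (Set.range α)) (maximalIdeal R)).comap (reesPresentation α) =
      nonunitPoly R _ := by
  ext F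
  rw [Ideal.mem_comap, mem_reesExtend_iff]
  constructor
  · intro h
    rw [mem_nonunitPoly]
    intro e
    have h1 : MvPolynomial.homogeneousComponent e.degree F ∈ nonunitPolySubmodule R _ :=
      fiberRelations_le_nonunitPoly α hdim hQ hc e.degree
        ⟨by
          have := h e.degree
          rwa [coeff_reesPresentation] at this,
        MvPolynomial.homogeneousComponent_isHomogeneous _ F⟩
    have h2 := mem_nonunitPoly.1 h1 e
    rwa [MvPolynomial.coeff_homogeneousComponent, if_pos rfl] at h2
  · intro h n
    rw [coeff_reesPresentation]
    refine aeval_mem_of_mem_nonunitPoly α (mem_nonunitPoly.2 fun e => ?_)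
      (MvPolynomial.homogeneousComponent_isHomogeneous n F)
    rw [MvPolynomial.coeff_homogeneousComponent]
    split_ifs
    · exact mem_nonunitPoly.1 h e
    · exact zero_mem _

/-- `m ℛ(Q)` is a prime ideal for a parameter ideal `Q`. -/
theorem reesExtend_isPrime (hdim : ¬ ringKrullDim R ≤ D)
    (hQ : Ideal.span (Set.range α) ≤ maximalIdeal R) {c : ℕ}
    (hc : maximalIdeal R ^ c ≤ Ideal.span (Set.range α)) :
    (reesExtend (Ideal.span (Set.range α)) (maximalIdeal R)).IsPrime := by
  have h := comap_reesExtend α hdim hQ hc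
  have h2 : (Ideal.comap (reesPresentation α)
      (reesExtend (Ideal.span (Set.range α)) (maximalIdeal R))).IsPrime :=
    h ▸ nonunitPoly_isPrime _
  rw [← Ideal.map_comap_of_surjective _ (reesPresentation_surjective α) (reesExtend _ _)]
  refine Ideal.map_isPrime_of_surjective (reesPresentation_surjective α) ?_
  intro x hx
  rw [Ideal.mem_comap, (RingHom.mem_ker).1 hx]
  exact zero_mem _

end ReesPrime

end SallySum

namespace SallySum

/-! ### Eventually polynomial functions in the binomial basis -/

section EventuallyPolynomial

/-- `f` eventually agrees with an integer combination of `binom (n + i, i)`, `i < s`, that is, with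
a polynomial of degree less than `s`. -/
def EvPoly (s : ℕ) (f : ℕ → ℤ) : Prop :=
  ∃ c : ℕ → ℤ, ∀ᶠ n in atTop, f n = ∑ i ∈ Finset.range s, c i * ((n + i).choose i : ℤ)

lemma EvPoly.sub {s : ℕ} {f g : ℕ → ℤ} (hf : EvPoly s f) (hg : EvPoly s g) :
    EvPoly s (fun n => f n - g n) := by
  obtain ⟨c, hc⟩ := hf
  obtain ⟨c', hc'⟩ := hg
  refine ⟨fun i => c i - c' i, ?_⟩
  filter_upwards [hc, hc'] with n h1 h2
  rw [h1, h2, ← Finset.sum_sub_distrib]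
  exact Finset.sum_congr rfl fun i _ => by ring

lemma eventually_succ_iff {p : ℕ → Prop} :
    (∀ᶠ n in atTop, p (n + 1)) ↔ ∀ᶠ n in atTop, p n := by
  simp only [eventually_atTop]
  constructor
  · rintro ⟨N, hN⟩
    refine ⟨N + 1, fun n hn => ?_⟩
    obtain ⟨m, rfl⟩ : ∃ m, n = m + 1 := ⟨n - 1, by omega⟩
    exact hN m (by omega)
  · rintro ⟨N, hN⟩
    exact ⟨N, fun n hn => hN _ (by omega)⟩

/-- Pascal's rule `binom(n+i, i) = binom(n+1+i, i) - binom(n+1+(i-1), i-1)` rewrites a polynomial in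
`n` in terms of `n + 1`. -/
lemma sum_shift (s : ℕ) (c : ℕ → ℤ) (n : ℕ) :
    ∑ i ∈ Finset.range s, c i * ((n + i).choose i : ℤ) =
      ∑ i ∈ Finset.range s, (c i - if i + 1 < s then c (i + 1) else 0) *
        ((n + 1 + i).choose i : ℤ) := by
  have h1 : ∀ t, t < s → ∑ i ∈ Finset.range (t + 1), c i * ((n + i).choose i : ℤ) =
      ∑ i ∈ Finset.range (t + 1), (c i - if i < t then c (i + 1) else 0) *
        ((n + 1 + i).choose i : ℤ) := by
    intro t ht
    clear ht
    induction t with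
    | zero => simp
    | succ t ih =>
      rw [Finset.sum_range_succ, ih, Finset.sum_range_succ _ (t + 1),
        Finset.sum_range_succ _ t, Finset.sum_range_succ _ t]
      have h2 : ∑ i ∈ Finset.range t, (c i - if i < t + 1 then c (i + 1) else 0) *
          ((n + 1 + i).choose i : ℤ) = ∑ i ∈ Finset.range t, (c i - if i < t then c (i + 1) else 0) *
          ((n + 1 + i).choose i : ℤ) := by
        refine Finset.sum_congr rfl fun i hi => ?_
        have := Finset.mem_range.1 hi
        rw [if_pos this, if_pos (by omega)]
      have h3 : ((n + 1 + (t + 1)).choose (t + 1) : ℤ) =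
          (n + (t + 1)).choose (t + 1) + (n + 1 + t).choose t := by
        have e1 : n + 1 + (t + 1) = n + 1 + t + 1 := by ring
        have e2 : n + (t + 1) = n + 1 + t := by ring
        rw [e1, e2, Nat.choose_succ_succ]
        push_cast
        ring
      rw [h2, h3]
      simp only [lt_self_iff_false, if_false, Nat.lt_succ_self, if_true]
      ring
  rcases s with _ | t
  · simp
  · rw [h1 t (Nat.lt_succ_self t)]
    simp only [Nat.succ_lt_succ_iff]

lemma EvPoly.shift {s : ℕ} {f g : ℕ → ℤ} (h : EvPoly s f) (hg : ∀ n, g (n + 1) = f n) :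
    EvPoly s g := by
  obtain ⟨c, hc⟩ := h
  refine ⟨fun i => c i - if i + 1 < s then c (i + 1) else 0,
    (eventually_succ_iff (p := fun n => g n = _)).1 ?_⟩
  filter_upwards [hc] with n hn
  rw [hg, hn, sum_shift]

lemma eventually_const_of_succ_eq {f : ℕ → ℤ} (h : ∀ᶠ n in atTop, f (n + 1) = f n) :
    ∃ a, ∀ᶠ n in atTop, f n = a := by
  obtain ⟨N, hN⟩ := eventually_atTop.1 h
  refine ⟨f N, eventually_atTop.2 ⟨N, fun n hn => ?_⟩⟩
  induction n, hn using Nat.le_induction with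
  | base => rfl
  | succ n hn ih => rw [hN n hn, ih]

/-- Discrete integration: the difference of `binom(n+i+1, i+1)` is `binom(n+1+i, i)`, so
coefficients move up one index and the constant of integration takes index `0`. -/
lemma EvPoly.of_diff {s : ℕ} {f g : ℕ → ℤ} (h : EvPoly s g)
    (hf : ∀ᶠ n in atTop, f (n + 1) - f n = g (n + 1)) : EvPoly (s + 1) f := by
  obtain ⟨c, hc⟩ := h
  let F : ℕ → ℤ := fun n => ∑ i ∈ Finset.range s, c i * ((n + (i + 1)).choose (i + 1) : ℤ)
  have hF : ∀ n, F (n + 1) - F n = ∑ i ∈ Finset.range s, c i * ((n + 1 + i).choose i : ℤ) := by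
    intro n
    rw [← Finset.sum_sub_distrib]
    refine Finset.sum_congr rfl fun i _ => ?_
    have e1 : n + 1 + (i + 1) = n + 1 + i + 1 := by ring
    have e2 : n + (i + 1) = n + 1 + i := by ring
    rw [e1, e2, Nat.choose_succ_succ]
    push_cast
    ring
  obtain ⟨a, ha⟩ := eventually_const_of_succ_eq (f := fun n => f n - F n) (by
    filter_upwards [hf, eventually_succ_iff.2 hc] with n h1 h2
    have := hF n
    rw [h2] at h1
    linarith)
  refine ⟨fun i => if i = 0 then a else c (i - 1), ?_⟩
  filter_upwards [ha] with n hn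
  rw [Finset.sum_range_succ']
  simp only [Nat.succ_ne_zero, if_false, Nat.add_sub_cancel, if_true, add_zero, Nat.choose_zero_right]
  have : F n = ∑ i ∈ Finset.range s, c i * ((n + (i + 1)).choose (i + 1) : ℤ) := rfl
  rw [← this]
  push_cast
  linarith

end EventuallyPolynomial

/-! ### Hilbert–Serre for sequences of ideals -/

section HilbertSerre

variable {R : Type*} [CommRing R]

/-- The sequence of ideals `U` satisfies `a U n ⊆ U (n + 1)` for all `a` in the list `l`. -/
def ClosedUnder (l : List R) (U : ℕ → Ideal R) : Prop :=
  ∀ a ∈ l, ∀ n, ∀ x ∈ U n, a * x ∈ U (n + 1)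

/-- The sequences of ideals between `V` and `W` that are closed under multiplication by `l`. -/
def Between (l : List R) (V W : ℕ → Ideal R) : Type _ :=
  {U : ℕ → Ideal R // V ≤ U ∧ U ≤ W ∧ ClosedUnder l U}

instance (l : List R) (V W : ℕ → Ideal R) : PartialOrder (Between l V W) :=
  inferInstanceAs (PartialOrder {U : ℕ → Ideal R // V ≤ U ∧ U ≤ W ∧ ClosedUnder l U})

/-- The map between posets `Between` induced by an inclusion. -/
def Between.incl {l l' : List R} {V W V' W' : ℕ → Ideal R} (hV : V ≤ V') (hW : W' ≤ W)
    (h : ∀ U, V' ≤ U → U ≤ W' → ClosedUnder l' U → ClosedUnder l U) (U : Between l' V' W') :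
    Between l V W :=
  ⟨U.1, hV.trans U.2.1, U.2.2.1.trans hW, h U.1 U.2.1 U.2.2.1 U.2.2.2⟩

lemma Between.wellFoundedGT {l l' : List R} {V W V' W' : ℕ → Ideal R} (hV : V ≤ V') (hW : W' ≤ W)
    (h : ∀ U, V' ≤ U → U ≤ W' → ClosedUnder l' U → ClosedUnder l U)
    [WellFoundedGT (Between l V W)] : WellFoundedGT (Between l' V' W') := by
  have hs : StrictMono (Between.incl hV hW h) := fun _ _ h => h
  exact hs.wellFoundedGT

/-- With no multiplications to respect, the sequences equal to `W` below `k` and to `V` from `k` on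
form a chain in `k`; it stabilizes only if `V` and `W` eventually agree. -/
lemma eventually_eq_of_wellFoundedGT {V W : ℕ → Ideal R} (hVW : V ≤ W)
    [WellFoundedGT (Between [] V W)] : ∀ᶠ n in atTop, V n = W n := by
  let U : ℕ →o Between [] V W :=
    { toFun := fun k => ⟨fun n => if n < k then W n else V n, fun n => by
          simp only; split_ifs
          · exact hVW n
          · exact le_rfl, fun n => by
          simp only; split_ifs
          · exact le_rfl
          · exact hVW n, by simp [ClosedUnder]⟩
      monotone' := fun k k' hk n => by
          simp only
          split_ifs
          · exact le_rfl
          · omega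
          · exact hVW n
          · exact le_rfl }
  obtain ⟨N, hN⟩ := WellFoundedGT.monotone_chain_condition U
  refine eventually_atTop.2 ⟨N, fun n hn => ?_⟩
  have h1 := (hN n hn).symm.trans (hN (n + 1) (by omega))
  have h2 : (if n < n then W n else V n) = if n < n + 1 then W n else V n :=
    congr_fun (congr_arg Subtype.val h1) n
  simpa using h2

/-- **Hilbert–Serre**: the Hilbert function of a Noetherian graded module, given as a quotient
`W / V` of sequences of ideals closed under multiplication by a list `l` of elements of degree one,
is eventually a polynomial of degree less than the length of `l`. -/
theorem evPoly_relLen (l : List R) : ∀ (V W : ℕ → Ideal R), V ≤ W → ClosedUnder l V →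
    ClosedUnder l W → WellFoundedGT (Between l V W) → (∀ n, relLen (V n) (W n) ≠ ⊤) →
    EvPoly l.length fun n => ((relLen (V n) (W n)).toNat : ℤ) := by
  induction l with
  | nil =>
    intro V W hVW _ _ hwf _
    refine ⟨0, ?_⟩
    filter_upwards [eventually_eq_of_wellFoundedGT hVW] with n hn
    have : relLen (V n) (W n) = 0 := relLen_eq_zero_iff.2 hn.ge
    simp [this]
  | cons a l ih =>
    intro V W hVW hV hW hwf hfin
    -- `K/V` and `W/V'` are the kernel and cokernel of multiplication by `a` from `W/V` to its shift
    -- by one degree. In degree `0` nothing is hit, so `V' 0 = V 0`.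
    let K : ℕ → Ideal R := fun n => Submodule.comap (LinearMap.mulLeft R a) (V (n + 1)) ⊓ W n
    let V' : ℕ → Ideal R := fun n => n.casesOn (V 0) fun n => V (n + 1) ⊔ Ideal.span {a} * W n
    have hVK : V ≤ K := fun n x hx => ⟨hV a (by simp) n x hx, hVW n hx⟩
    have hKW : K ≤ W := fun n => inf_le_right
    have hVV' : V ≤ V' := fun n => by
      cases n with
      | zero => exact le_rfl
      | succ n => exact le_sup_left
    have haW : ∀ n, Ideal.span {a} * W n ≤ W (n + 1) := by
      intro n
      rw [Ideal.span_singleton_mul_le_iff]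
      exact hW a (by simp) n
    have hV'W : V' ≤ W := fun n => by
      cases n with
      | zero => exact hVW 0
      | succ n => exact sup_le (hVW _) (haW n)
    have hK : ClosedUnder l K := by
      intro b hb n x hx
      refine ⟨?_, hW b (by simp [hb]) n x hx.2⟩
      change a * (b * x) ∈ V (n + 1 + 1)
      rw [mul_left_comm]
      exact hV b (by simp [hb]) _ _ hx.1
    have hV' : ClosedUnder l V' := by
      intro b hb n x hx
      cases n with
      | zero => exact Ideal.mem_sup_left (hV b (by simp [hb]) 0 x hx)
      | succ n =>
        obtain ⟨v, hv, y, hy, rfl⟩ := Submodule.mem_sup.1 hx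
        obtain ⟨w, hw, rfl⟩ := Ideal.mem_span_singleton_mul.1 hy
        rw [mul_add, mul_left_comm]
        exact add_mem (Ideal.mem_sup_left (hV b (by simp [hb]) _ _ hv))
          (Ideal.mem_sup_right (Ideal.mem_span_singleton_mul.2
            ⟨_, hW b (by simp [hb]) _ _ hw, rfl⟩))
    have hWl : ClosedUnder l W := fun b hb => hW b (by simp [hb])
    have hVl : ClosedUnder l V := fun b hb => hV b (by simp [hb])
    -- Both `K/V` and `W/V'` are killed by `a`, so closure under `a` is automatic and the chain
    -- condition for `a :: l` descends to `l`.
    have wf1 : WellFoundedGT (Between l V K) := by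
      refine Between.wellFoundedGT (l := a :: l) (le_refl V) hKW fun U hVU hUK hU b hb n x hx => ?_
      rcases List.mem_cons.1 hb with rfl | hb
      · exact hVU _ (hUK n hx).1
      · exact hU b hb n x hx
    have wf2 : WellFoundedGT (Between l V' W) := by
      refine Between.wellFoundedGT (l := a :: l) hVV' (le_refl W) fun U hVU hUW hU b hb n x hx => ?_
      rcases List.mem_cons.1 hb with rfl | hb
      · exact hVU (n + 1) (Ideal.mem_sup_right
          (Ideal.mem_span_singleton_mul.2 ⟨x, hUW n hx, rfl⟩))
      · exact hU b hb n x hx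
    have fin1 : ∀ n, relLen (V n) (K n) ≠ ⊤ := fun n =>
      ne_top_of_le_ne_top (hfin n) (relLen_le_right _ (hKW n))
    have fin2 : ∀ n, relLen (V' n) (W n) ≠ ⊤ := fun n =>
      ne_top_of_le_ne_top (hfin n) (relLen_le_left (hVV' n) _)
    have p1 := ih V K hVK hVl hK wf1 fin1
    have p2 := ih V' W hV'W hV' hWl wf2 fin2
    refine (p2.sub (p1.shift (g := fun n => n.casesOn 0
      fun n => ((relLen (V n) (K n)).toNat : ℤ)) fun n => rfl)).of_diff (Eventually.of_forall ?_)
    intro n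
    have e1 := relLen_add (hVV' (n + 1)) (hV'W (n + 1))
    have e2 := relLen_add (hVK n) (hKW n)
    have e3 : relLen (V (n + 1)) (V' (n + 1)) = relLen (K n) (W n) :=
      (relLen_sup_span_mul _ _ _).trans (relLen_inf _ _).symm
    have fin3 : relLen (K n) (W n) ≠ ⊤ :=
      ne_top_of_le_ne_top (hfin n) (relLen_le_left (hVK n) _)
    rw [e3] at e1
    have e1' := congr_arg ENat.toNat e1
    have e2' := congr_arg ENat.toNat e2
    rw [ENat.toNat_add fin3 (fin2 (n + 1))] at e1'
    rw [ENat.toNat_add (fin1 n) fin3] at e2'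
    simp only
    omega

end HilbertSerre

end SallySum

namespace SallySum

/-! ### Length after localization at a prime -/

section LocalLength

variable {T : Type*} [CommRing T] (p : Ideal T) [p.IsPrime]

/-- The map of `T_p`-modules `M_p → N_p` induced by a `T`-linear map. -/
noncomputable def localizedMap {M N : Type*} [AddCommGroup M] [Module T M] [AddCommGroup N]
    [Module T N] (g : M →ₗ[T] N) : LocalizedModule p.primeCompl M →ₗ[Localization.AtPrime p]
      LocalizedModule p.primeCompl N :=
  IsLocalizedModule.mapExtendScalars p.primeCompl
    (LocalizedModule.mkLinearMap p.primeCompl M) (LocalizedModule.mkLinearMap p.primeCompl N)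
    (Localization.AtPrime p) g

lemma localLength_eq_add {M N P : Type*} [AddCommGroup M] [Module T M] [AddCommGroup N]
    [Module T N] [AddCommGroup P] [Module T P] (f : N →ₗ[T] M) (g : M →ₗ[T] P)
    (hf : Function.Injective f) (hg : Function.Surjective g) (H : Function.Exact f g) :
    localLength p M = localLength p N + localLength p P := by
  refine Module.length_eq_add_of_exact (localizedMap p f) (localizedMap p g) ?_ ?_ ?_
  · exact IsLocalizedModule.map_injective p.primeCompl _ _ f hf
  · exact IsLocalizedModule.map_surjective p.primeCompl _ _ g hg
  · exact IsLocalizedModule.map_exact p.primeCompl _ _ _ f g H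

lemma localLength_eq_zero {M : Type*} [AddCommGroup M] [Module T M] {t : T} (ht : t ∉ p)
    (h : ∀ x : M, t • x = 0) : localLength p M = 0 := by
  rw [localLength, Module.length_eq_zero_iff]
  refine ⟨fun x y => ?_⟩
  have key : ∀ x : LocalizedModule p.primeCompl M, x = 0 := by
    intro x
    induction x using LocalizedModule.induction_on with
    | h m s =>
      rw [← LocalizedModule.zero_mk 1, LocalizedModule.mk_eq]
      refine ⟨⟨t, ht⟩, ?_⟩
      change t • (1 : p.primeCompl) • m = t • s • (0 : M)
      rw [one_smul, smul_zero, smul_zero, h]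
  rw [key x, key y]

lemma localLength_congr {M N : Type*} [AddCommGroup M] [Module T M] [AddCommGroup N] [Module T N]
    (e : M ≃ₗ[T] N) : localLength p M = localLength p N := by
  have h := localLength_eq_add p (e : M →ₗ[T] N) (0 : N →ₗ[T] PUnit) e.injective
    (fun _ => ⟨0, rfl⟩) (fun y => by simp)
  rw [h, localLength_eq_zero p (M := PUnit) (t := 1) ((Ideal.ne_top_iff_one p).1 ‹p.IsPrime›.ne_top)
    (fun _ => rfl), add_zero]

/-- The module is cyclic with annihilator `p`, that is `T/p`, which localizes to the residue field
of `T_p`. -/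
lemma localLength_eq_one {M : Type*} [AddCommGroup M] [Module T M] (f : M)
    (hf : ∀ x : M, ∃ t : T, t • f = x) (hann : ∀ t : T, t • f = 0 ↔ t ∈ p) :
    localLength p M = 1 := by
  rw [localLength, Module.length_eq_one_iff, isSimpleModule_iff_toSpanSingleton_surjective]
  have hzero : ∀ (t : T) (s : p.primeCompl),
      (LocalizedModule.mk (t • f) s : LocalizedModule p.primeCompl M) = 0 ↔ t ∈ p := by
    intro t s
    rw [← LocalizedModule.zero_mk 1, LocalizedModule.mk_eq]
    constructor
    · rintro ⟨u, hu⟩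
      have hu' : (u : T) • (1 : p.primeCompl) • t • f = (u : T) • s • (0 : M) := hu
      rw [one_smul, smul_zero, smul_zero, smul_smul, hann] at hu'
      exact (Ideal.IsPrime.mem_or_mem inferInstance hu').resolve_left u.2
    · intro ht
      rw [(hann t).2 ht]
      exact ⟨1, by simp⟩
  constructor
  · refine ⟨LocalizedModule.mk ((1 : T) • f) 1, 0, fun h => ?_⟩
    exact (Ideal.ne_top_iff_one p).1 ‹p.IsPrime›.ne_top ((hzero 1 1).1 h)
  · intro x hx y
    induction x using LocalizedModule.induction_on with
    | h m s =>
      induction y using LocalizedModule.induction_on with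
      | h m' s' =>
        obtain ⟨t, rfl⟩ := hf m
        obtain ⟨t', rfl⟩ := hf m'
        have ht : t ∉ p := fun h => hx ((hzero t s).2 h)
        refine ⟨Localization.mk (t' * s) (s' * ⟨t, ht⟩), ?_⟩
        rw [LinearMap.toSpanSingleton_apply, LocalizedModule.mk_smul_mk, LocalizedModule.mk_eq]
        refine ⟨1, ?_⟩
        change (1 : T) • (s' : T) • (t' * s) • t • f = (1 : T) • ((s' * t) * s : T) • t' • f
        simp only [smul_smul]
        congr 1
        ring

end LocalLength

/-! ### Graded modules over the Rees algebra -/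

section ReesGraded

open IsLocalRing

variable {R : Type*} [CommRing R] {Q : Ideal R}

/-- The graded `ℛ(Q)`-submodule `⨁ U n tⁿ` of `R[t]`. -/
noncomputable def gsub (Q : Ideal R) (U : ℕ → Ideal R) (h : ∀ n, Q * U n ≤ U (n + 1)) :
    Submodule (reesAlgebra Q) R[X] where
  carrier := {f | ∀ n, f.coeff n ∈ U n}
  add_mem' hf hg i := by rw [coeff_add]; exact add_mem (hf i) (hg i)
  zero_mem' _ := by rw [coeff_zero]; exact zero_mem _
  smul_mem' c f hf i := by
    have hpow : ∀ i j, Q ^ i * U j ≤ U (i + j) := by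
      intro i j
      induction i with
      | zero => simp
      | succ i ih =>
        rw [pow_succ', mul_assoc]
        exact ((Ideal.mul_mono_right ih).trans (h _)).trans (le_of_eq (by congr 1; ring))
    change ((c : R[X]) * f).coeff i ∈ U i
    rw [Polynomial.coeff_mul]
    refine sum_mem fun q hq => ?_
    rw [← Finset.HasAntidiagonal.mem_antidiagonal.1 hq]
    exact hpow _ _ (Ideal.mul_mem_mul ((mem_reesAlgebra_iff _ _).1 c.2 q.1) (hf q.2))

lemma mem_gsub {U : ℕ → Ideal R} {h : ∀ n, Q * U n ≤ U (n + 1)} {f : R[X]} :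
    f ∈ gsub Q U h ↔ ∀ n, f.coeff n ∈ U n := Iff.rfl

lemma monomial_mem_gsub {U : ℕ → Ideal R} {h : ∀ n, Q * U n ≤ U (n + 1)} {n : ℕ} {c : R} :
    monomial n c ∈ gsub Q U h ↔ c ∈ U n := by
  rw [mem_gsub]
  constructor
  · intro h
    simpa using h n
  · intro hc i
    rw [coeff_monomial]
    split_ifs with hi
    · exact hi ▸ hc
    · exact zero_mem _

lemma gsub_le_gsub {U V : ℕ → Ideal R} {hU : ∀ n, Q * U n ≤ U (n + 1)}
    {hV : ∀ n, Q * V n ≤ V (n + 1)} : gsub Q U hU ≤ gsub Q V hV ↔ U ≤ V :=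
  ⟨fun h _ _ hc => monomial_mem_gsub.1 (h (monomial_mem_gsub (h := hU).2 hc)),
    fun h _ hf n => h n (hf n)⟩

/-- A homogeneous element of the Rees algebra. -/
noncomputable def reesMonomial {Q : Ideal R} {n : ℕ} {c : R} (hc : c ∈ Q ^ n) : reesAlgebra Q :=
  ⟨monomial n c, reesAlgebra.monomial_mem.2 hc⟩

lemma reesMonomial_smul_monomial {n i : ℕ} {b c : R} (hb : b ∈ Q ^ n) :
    reesMonomial hb • (monomial i c : R[X]) = monomial (n + i) (b * c) := by
  change (monomial n b : R[X]) * monomial i c = _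
  rw [monomial_mul_monomial]

/-- The equality `m^{r+1} = Q m^r` propagates to all higher degrees, so generators of `m^0, …, m^r`
generate the whole module over the Noetherian ring `ℛ(Q)`. -/
lemma isNoetherian_gsub_pow [IsNoetherianRing R] {m : Ideal R} (h : ∀ n, Q * m ^ n ≤ m ^ (n + 1))
    {r : ℕ} (hr : m ^ (r + 1) = Q * m ^ r) :
    IsNoetherian (reesAlgebra Q) (gsub Q (fun n => m ^ n) h) := by
  have hfg : (gsub Q (fun n => m ^ n) h).FG := by
    choose S hS using fun j => (isNoetherianRing_iff_ideal_fg R).1 inferInstance (m ^ j)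
    classical
    let G : Finset R[X] := (Finset.range (r + 1)).biUnion fun j => (S j).image (monomial j)
    have hsmall : ∀ n ≤ r, ∀ c ∈ m ^ n, (monomial n c : R[X]) ∈
        Submodule.span (reesAlgebra Q) (G : Set R[X]) := by
      intro n hn c hc
      have hS' : Ideal.span (S n : Set R) = m ^ n := hS n
      rw [← hS'] at hc
      induction hc using Submodule.span_induction with
      | mem x hx =>
        exact Submodule.subset_span (Finset.mem_biUnion.2 ⟨n, Finset.mem_range.2 (by omega),
          Finset.mem_image_of_mem _ hx⟩)
      | zero => simp
      | add x y _ _ hx hy => rw [map_add]; exact add_mem hx hy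
      | smul a x _ hx =>
        have h1 : (monomial n (a • x) : R[X]) =
            (algebraMap R (reesAlgebra Q) a) • (monomial n x : R[X]) := by
          change _ = (algebraMap R R[X] a) * _
          rw [Polynomial.algebraMap_eq, Polynomial.C_mul_monomial, smul_eq_mul]
        rw [h1]
        exact Submodule.smul_mem _ _ hx
    have hle : ∀ n, ∀ c ∈ m ^ n, (monomial n c : R[X]) ∈
        Submodule.span (reesAlgebra Q) (G : Set R[X]) := by
      intro n
      rcases le_total n r with hn | hn
      · exact hsmall n hn
      induction n, hn using Nat.le_induction with
      | base => exact hsmall r le_rfl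
      | succ n hn ih =>
        intro c hc
        have h1 : m ^ (n + 1) = Q * m ^ n := by
          obtain ⟨i, rfl⟩ := Nat.exists_eq_add_of_le hn
          rw [add_right_comm, pow_add, hr, mul_assoc, ← pow_add]
        rw [h1] at hc
        induction hc using Submodule.mul_induction_on' with
        | mem_mul_mem q hq x hx =>
          have hq' : q ∈ Q ^ 1 := by rwa [pow_one]
          rw [add_comm, ← reesMonomial_smul_monomial hq']
          exact Submodule.smul_mem _ _ (ih x hx)
        | add x _ y _ hx hy => rw [map_add]; exact add_mem hx hy
    refine ⟨G, le_antisymm (Submodule.span_le.2 ?_) ?_⟩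
    · intro f hf
      obtain ⟨j, -, hj⟩ := Finset.mem_biUnion.1 hf
      obtain ⟨c, hc, rfl⟩ := Finset.mem_image.1 hj
      refine monomial_mem_gsub.2 ?_
      have : Ideal.span (S j : Set R) = m ^ j := hS j
      rw [← this]
      exact Ideal.subset_span hc
    · intro f hf
      rw [f.as_sum_support]
      exact sum_mem fun n _ => hle n _ (hf n)
  exact isNoetherian_of_fg_of_noetherian _ hfg

lemma closedUnder_ofFn_iff {d : ℕ} {α : Fin d → R} {U : ℕ → Ideal R} :
    ClosedUnder (List.ofFn α) U ↔ ∀ n, Ideal.span (Set.range α) * U n ≤ U (n + 1) := by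
  constructor
  · intro h n
    rw [Ideal.mul_le]
    intro a ha x hx
    induction ha using Submodule.span_induction with
    | mem a ha =>
      obtain ⟨i, rfl⟩ := ha
      exact h _ (List.mem_ofFn' _ _ |>.2 ⟨i, rfl⟩) n x hx
    | zero => simp
    | add a b _ _ ha hb => rw [add_mul]; exact add_mem ha hb
    | smul c a _ ha => rw [smul_eq_mul, mul_assoc]; exact Ideal.mul_mem_left _ _ ha
  · intro h a ha n x hx
    obtain ⟨i, rfl⟩ := (List.mem_ofFn' _ _).1 ha
    exact h n (Ideal.mul_mem_mul (Ideal.subset_span ⟨i, rfl⟩) hx)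

/-- `U ↦ ⨁ U n tⁿ` embeds the poset into the submodules of the Noetherian module `⨁ m^n t^n`. -/
lemma between_wellFoundedGT [IsNoetherianRing R] {d : ℕ} {α : Fin d → R} {m : Ideal R}
    (hQ : Ideal.span (Set.range α) ≤ m) {r : ℕ}
    (hr : m ^ (r + 1) = Ideal.span (Set.range α) * m ^ r) {V W : ℕ → Ideal R}
    (hW : ∀ n, W n ≤ m ^ n) : WellFoundedGT (Between (List.ofFn α) V W) := by
  have h : ∀ n, Ideal.span (Set.range α) * m ^ n ≤ m ^ (n + 1) := fun n => by
    rw [pow_succ']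
    exact Ideal.mul_mono_left hQ
  have := isNoetherian_gsub_pow h hr
  let E := gsub (Ideal.span (Set.range α)) (fun n => m ^ n) h
  let φ : Between (List.ofFn α) V W → Submodule (reesAlgebra (Ideal.span (Set.range α))) E :=
    fun U => (gsub _ U.1 (closedUnder_ofFn_iff.1 U.2.2.2)).comap E.subtype
  have hle : ∀ U U', φ U ≤ φ U' → U ≤ U' := by
    intro U U' hUU n c hc
    have hcE : (monomial n c : R[X]) ∈ E := monomial_mem_gsub.2 (hW n (U.2.2.1 n hc))
    have h1 : (⟨monomial n c, hcE⟩ : E) ∈ φ U :=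
      (monomial_mem_gsub (h := closedUnder_ofFn_iff.1 U.2.2.2)).2 hc
    exact (monomial_mem_gsub (h := closedUnder_ofFn_iff.1 U'.2.2.2)).1 (hUU h1)
  have hmono : Monotone φ := fun U U' hUU x hx n => hUU n (hx n)
  have hs : StrictMono φ := fun U U' hUU =>
    lt_of_le_not_ge (hmono hUU.le) fun h => hUU.not_ge (hle _ _ h)
  exact hs.wellFoundedGT

end ReesGraded

end SallySum

namespace SallySum

/-! ### Local length at `mT` as leading coefficient -/

section Rank

open IsLocalRing Topology

lemma tendsto_choose_div_pow (D a b : ℕ) :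
    Tendsto (fun j : ℕ => ((j + a).choose D : ℝ) / ((j + b : ℕ) : ℝ) ^ D) atTop
      (𝓝 (1 / (D.factorial : ℝ))) := by
  have h1 : Tendsto (fun n : ℕ => (n.choose D : ℝ) / (n : ℝ) ^ D) atTop
      (𝓝 (1 / (D.factorial : ℝ))) := by
    have h := (Asymptotics.isEquivalent_iff_tendsto_one (by
      filter_upwards [eventually_gt_atTop 0] with n hn
      have : (0 : ℝ) < n := by exact_mod_cast hn
      positivity)).1 (isEquivalent_choose D)
    have h2 := h.mul_const (1 / (D.factorial : ℝ))
    rw [one_mul] at h2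
    refine h2.congr' ?_
    filter_upwards [eventually_gt_atTop 0] with n hn
    have : (0 : ℝ) < n := by exact_mod_cast hn
    have h3 : (D.factorial : ℝ) ≠ 0 := by positivity
    simp only [Pi.div_apply]
    field_simp
  have h2 : Tendsto (fun j : ℕ => ((j + a : ℕ) : ℝ) / ((j + b : ℕ) : ℝ)) atTop (𝓝 1) := by
    have h3 : Tendsto (fun j : ℕ => 1 + ((a : ℝ) - b) / ((j + b : ℕ) : ℝ)) atTop (𝓝 (1 + 0)) := by
      refine tendsto_const_nhds.add (tendsto_const_nhds.div_atTop ?_)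
      exact tendsto_natCast_atTop_atTop.comp (tendsto_add_atTop_nat b)
    rw [add_zero] at h3
    refine h3.congr' ?_
    filter_upwards [eventually_gt_atTop 0] with j hj
    have : ((j + b : ℕ) : ℝ) ≠ 0 := by positivity
    rw [eq_div_iff this, add_mul, div_mul_cancel₀ _ this]
    push_cast
    ring
  have h3 := (h1.comp (tendsto_add_atTop_nat a)).mul (h2.pow D)
  rw [one_pow, mul_one] at h3
  refine h3.congr' ?_
  filter_upwards [eventually_gt_atTop 0] with j hj
  have hja : ((j + a : ℕ) : ℝ) ≠ 0 := by positivity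
  have hjb : ((j + b : ℕ) : ℝ) ≠ 0 := by positivity
  simp only [Function.comp]
  rw [div_pow]
  field_simp

variable {R : Type*} [CommRing R] {Q m : Ideal R}

/-- The quotient `W / V` of graded `ℛ(Q)`-modules has finite length `l` after localization at `p`,
and its Hilbert function grows like `l n ^ D / D!`. -/
def HasRank (p : Ideal (reesAlgebra Q)) [p.IsPrime] (D : ℕ) (V W : ℕ → Ideal R)
    (hV : ∀ n, Q * V n ≤ V (n + 1)) (hW : ∀ n, Q * W n ≤ W (n + 1)) : Prop :=
  ∃ l : ℕ, localLength p (Subquotient (gsub Q V hV) (gsub Q W hW)) = l ∧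
    Tendsto (fun n : ℕ => ((relLen (V n) (W n)).toNat : ℝ) / (n : ℝ) ^ D) atTop
      (𝓝 (l / (D.factorial : ℝ)))

variable (p : Ideal (reesAlgebra Q)) [p.IsPrime] {D : ℕ}

lemma HasRank.refl (V : ℕ → Ideal R) (hV : ∀ n, Q * V n ≤ V (n + 1)) : HasRank p D V V hV hV := by
  refine ⟨0, ?_, ?_⟩
  · rw [localLength_eq_zero p (t := 1) ((Ideal.ne_top_iff_one p).1 ‹p.IsPrime›.ne_top)]
    · rfl
    · intro x
      induction x using Submodule.Quotient.induction_on with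
      | H x =>
        rw [one_smul, Submodule.Quotient.mk_eq_zero]
        exact x.2
  · have : ∀ n, relLen (V n) (V n) = 0 := fun n => relLen_eq_zero_iff.2 le_rfl
    simp [this]

variable {p}

lemma HasRank.trans {V U W : ℕ → Ideal R} {hV : ∀ n, Q * V n ≤ V (n + 1)}
    {hU : ∀ n, Q * U n ≤ U (n + 1)} {hW : ∀ n, Q * W n ≤ W (n + 1)} (h1 : HasRank p D V U hV hU)
    (h2 : HasRank p D U W hU hW) (hVU : V ≤ U) (hUW : U ≤ W)
    (hfin : ∀ n, relLen (V n) (W n) ≠ ⊤) : HasRank p D V W hV hW := by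
  obtain ⟨l, hl, hl'⟩ := h1
  obtain ⟨l', hl2, hl2'⟩ := h2
  have hVU' := (gsub_le_gsub (hU := hV) (hV := hU)).2 hVU
  have hUW' := (gsub_le_gsub (hU := hU) (hV := hW)).2 hUW
  refine ⟨l + l', ?_, ?_⟩
  · rw [localLength_eq_add p _ _ (Subquotient.incl_injective _ hUW')
      (Subquotient.proj_surjective hVU' _) (Subquotient.exact hVU' hUW'), hl, hl2]
    simp
  · have h3 := hl'.add hl2'
    rw [Nat.cast_add, add_div]
    refine h3.congr fun n => ?_
    rw [← add_div, ← Nat.cast_add, ← ENat.toNat_add, relLen_add (hVU n) (hUW n)]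
    · exact ne_top_of_le_ne_top (hfin n) (relLen_le_right _ (hUW n))
    · exact ne_top_of_le_ne_top (hfin n) (relLen_le_left (hVU n) _)

/-- The graded module generated by `⨁ U n tⁿ` and `c tʳ`. -/
def adjoinMonomial (Q : Ideal R) (U : ℕ → Ideal R) (r : ℕ) (c : R) (n : ℕ) : Ideal R :=
  U n ⊔ if r ≤ n then Ideal.span {c} * Q ^ (n - r) else ⊥

lemma adjoinMonomial_closed {U : ℕ → Ideal R} (hU : ∀ n, Q * U n ≤ U (n + 1)) (r : ℕ) (c : R)
    (n : ℕ) : Q * adjoinMonomial Q U r c n ≤ adjoinMonomial Q U r c (n + 1) := by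
  rw [adjoinMonomial, adjoinMonomial, Ideal.mul_sup]
  refine sup_le_sup (hU n) ?_
  split_ifs with h1 h2 h2
  · rw [mul_left_comm, ← pow_succ', Nat.sub_add_comm h1]
  · omega
  · simp
  · simp

lemma adjoinMonomial_add (U : ℕ → Ideal R) (r : ℕ) (c : R) (j : ℕ) :
    adjoinMonomial Q U r c (r + j) = U (r + j) ⊔ Ideal.span {c} * Q ^ j := by
  rw [adjoinMonomial, if_pos (by omega), Nat.add_sub_cancel_left]

lemma le_adjoinMonomial (U : ℕ → Ideal R) (r : ℕ) (c : R) : U ≤ adjoinMonomial Q U r c :=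
  fun _ => le_sup_left

lemma mem_adjoinMonomial (U : ℕ → Ideal R) (r : ℕ) (c : R) : c ∈ adjoinMonomial Q U r c r := by
  have := adjoinMonomial_add (Q := Q) U r c 0
  rw [add_zero] at this
  rw [this, pow_zero, mul_one]
  exact Ideal.mem_sup_right (Ideal.mem_span_singleton_self c)

lemma adjoinMonomial_le {U W : ℕ → Ideal R} (hUW : U ≤ W) (hW : ∀ n, Q * W n ≤ W (n + 1)) {r : ℕ}
    {c : R} (hc : c ∈ W r) : adjoinMonomial Q U r c ≤ W := by
  intro n
  refine sup_le (hUW n) ?_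
  split_ifs with h
  · obtain ⟨j, rfl⟩ := Nat.exists_eq_add_of_le h
    rw [Nat.add_sub_cancel_left]
    induction j with
    | zero => simpa using hc
    | succ j ih =>
      rw [pow_succ', mul_left_comm]
      exact (Ideal.mul_mono_right (ih (by omega))).trans (hW _)
  · exact bot_le

lemma exists_smul_sub_mem {U : ℕ → Ideal R} (hU : ∀ n, Q * U n ≤ U (n + 1)) (r : ℕ) (c : R)
    {g : R[X]} (hg : g ∈ gsub Q (adjoinMonomial Q U r c) (adjoinMonomial_closed hU r c)) :
    ∃ t : reesAlgebra Q, g - t • (monomial r c : R[X]) ∈ gsub Q U hU := by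
  have key : ∀ n, ∃ t : reesAlgebra Q,
      (monomial n (g.coeff n) : R[X]) - t • (monomial r c : R[X]) ∈ gsub Q U hU := by
    intro n
    obtain ⟨u, hu, y, hy, huy⟩ := Submodule.mem_sup.1 (hg n)
    split_ifs at hy with h
    · obtain ⟨q, hq, rfl⟩ := Ideal.mem_span_singleton_mul.1 hy
      refine ⟨reesMonomial hq, ?_⟩
      rw [reesMonomial_smul_monomial, Nat.sub_add_cancel h, mul_comm q c, ← map_sub, ← huy,
        add_sub_cancel_right]
      exact monomial_mem_gsub.2 hu
    · refine ⟨0, ?_⟩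
      rw [(Submodule.mem_bot R).1 hy, add_zero] at huy
      rw [zero_smul, sub_zero, ← huy]
      exact monomial_mem_gsub.2 hu
  choose t ht using key
  refine ⟨∑ n ∈ g.support, t n, ?_⟩
  rw [Finset.sum_smul]
  nth_rewrite 1 [g.as_sum_support]
  rw [← Finset.sum_sub_distrib]
  exact sum_mem fun n _ => ht n

lemma coeff_smul_monomial (t : reesAlgebra Q) (r : ℕ) (c : R) (j : ℕ) :
    (t • (monomial r c : R[X])).coeff (r + j) = (t : R[X]).coeff j * c := by
  change ((t : R[X]) * monomial r c).coeff (r + j) = _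
  rw [add_comm, coeff_mul_monomial]

lemma smul_monomial_mem_gsub_iff {U : ℕ → Ideal R} {hU : ∀ n, Q * U n ≤ U (n + 1)}
    (t : reesAlgebra Q) (r : ℕ) (c : R) :
    t • (monomial r c : R[X]) ∈ gsub Q U hU ↔ ∀ j, (t : R[X]).coeff j * c ∈ U (r + j) := by
  rw [mem_gsub]
  constructor
  · intro h j
    rw [← coeff_smul_monomial]
    exact h _
  · intro h n
    by_cases hn : r ≤ n
    · obtain ⟨j, rfl⟩ := Nat.exists_eq_add_of_le hn
      rw [coeff_smul_monomial]
      exact h j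
    · change ((t : R[X]) * monomial r c).coeff n ∈ _
      have : ((t : R[X]) * monomial r c).coeff n = 0 := by
        rw [← C_mul_X_pow_eq_monomial, ← mul_assoc, coeff_mul_X_pow', if_neg hn]
      rw [this]
      exact zero_mem _

lemma mul_pow_le_of_mul_le {U : ℕ → Ideal R} (hU : ∀ n, Q * U n ≤ U (n + 1)) {r : ℕ} {c : R}
    (hc : ∀ x ∈ m, x * c ∈ U r) (j : ℕ) :
    m * Q ^ j ≤ Submodule.comap (LinearMap.mulLeft R c) (U (r + j)) := by
  have h1 : Ideal.span {c} * m * Q ^ j ≤ U (r + j) := by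
    induction j with
    | zero =>
      rw [pow_zero, mul_one, Ideal.span_singleton_mul_le_iff]
      intro x hx
      rw [mul_comm]
      exact hc x hx
    | succ j ih =>
      rw [pow_succ', mul_left_comm]
      exact (Ideal.mul_mono_right ih).trans (hU _)
  intro x hx
  refine h1 ?_
  rw [mul_assoc]
  exact Ideal.mem_span_singleton_mul.2 ⟨x, hx, rfl⟩

variable (hp : ∀ f : reesAlgebra Q, f ∈ p ↔ ∀ n, (f : R[X]).coeff n ∈ m * Q ^ n)
  (hh : ∀ j, relLen (m * Q ^ j) (Q ^ j) = ((j + D).choose D : ℕ))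

include hp hh in
-- The class of `c t^r` modulo `U` is killed by `p`. Either `p` is its whole annihilator and the
-- piece is a shifted `T/p`, of rank `1`, or a homogeneous `b t^s` outside `p` kills it, and the
-- rank is `0`.
lemma hasRank_adjoinMonomial {U : ℕ → Ideal R} (hU : ∀ n, Q * U n ≤ U (n + 1)) {r : ℕ} {c : R}
    (hc : ∀ x ∈ m, x * c ∈ U r) :
    HasRank p D U (adjoinMonomial Q U r c) hU (adjoinMonomial_closed hU r c) := by
  have hmQ := mul_pow_le_of_mul_le hU hc
  have hfmem : (monomial r c : R[X]) ∈
      gsub Q (adjoinMonomial Q U r c) (adjoinMonomial_closed hU r c) :=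
    monomial_mem_gsub.2 (mem_adjoinMonomial U r c)
  have hrel : ∀ j, relLen (U (r + j)) (adjoinMonomial Q U r c (r + j)) =
      relLen (Submodule.comap (LinearMap.mulLeft R c) (U (r + j))) (Q ^ j) := by
    intro j
    rw [adjoinMonomial_add, relLen_sup_span_mul]
  by_cases hcase : ∀ j, ∀ b ∈ Q ^ j, b * c ∈ U (r + j) → b ∈ m * Q ^ j
  · refine ⟨1, ?_, ?_⟩
    · rw [Nat.cast_one]
      refine localLength_eq_one p (Submodule.Quotient.mk ⟨monomial r c, hfmem⟩) ?_ ?_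
      · intro x
        induction x using Submodule.Quotient.induction_on with
        | H x =>
          obtain ⟨t, ht⟩ := exists_smul_sub_mem hU r c x.2
          refine ⟨t, Eq.symm ?_⟩
          rw [← Submodule.Quotient.mk_smul, Submodule.Quotient.eq]
          exact ht
      · intro t
        rw [← Submodule.Quotient.mk_smul, Submodule.Quotient.mk_eq_zero]
        change t • (monomial r c : R[X]) ∈ gsub Q U hU ↔ _
        rw [smul_monomial_mem_gsub_iff, hp]
        refine forall_congr' fun j => ⟨hcase j _ ((mem_reesAlgebra_iff _ _).1 t.2 j), fun h => ?_⟩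
        rw [mul_comm]
        exact hmQ j h
    · rw [← tendsto_add_atTop_iff_nat r, Nat.cast_one]
      refine (tendsto_choose_div_pow D D r).congr fun j => ?_
      rw [add_comm j r, hrel, ← relLen_inf]
      have : Submodule.comap (LinearMap.mulLeft R c) (U (r + j)) ⊓ Q ^ j = m * Q ^ j := by
        refine le_antisymm (fun b hb => hcase j b hb.2 ?_) (le_inf (hmQ j) Ideal.mul_le_right)
        rw [mul_comm]
        exact hb.1
      rw [this, hh, ENat.toNat_natCast]
  · push Not at hcase
    obtain ⟨s, b, hb, hbc, hbm⟩ := hcase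
    have ht : reesMonomial hb ∉ p := by
      rw [hp]
      intro h
      exact hbm (by simpa [reesMonomial] using h s)
    refine ⟨0, ?_, ?_⟩
    · rw [Nat.cast_zero]
      refine localLength_eq_zero p ht fun x => ?_
      induction x using Submodule.Quotient.induction_on with
      | H x =>
        obtain ⟨t, ht⟩ := exists_smul_sub_mem hU r c x.2
        rw [← Submodule.Quotient.mk_smul, Submodule.Quotient.mk_eq_zero]
        change reesMonomial hb • (x : R[X]) ∈ gsub Q U hU
        have h1 : reesMonomial hb • (x : R[X]) =
            reesMonomial hb • ((x : R[X]) - t • (monomial r c : R[X])) +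
            t • (reesMonomial hb • (monomial r c : R[X])) := by
          rw [smul_sub, smul_comm, sub_add_cancel]
        rw [h1, reesMonomial_smul_monomial, add_comm s r]
        exact add_mem (Submodule.smul_mem _ _ ht)
          (Submodule.smul_mem _ _ (monomial_mem_gsub.2 hbc))
    -- In degree `s + j` of the fiber cone the multiples of `b t^s` are lost. Since `p` is prime and
    -- misses `b t^s`, they have length at least `binom(j+D, D)`, so what survives is `o(n^D)`.
    · have hbound : ∀ j, (relLen (U (r + (s + j))) (adjoinMonomial Q U r c (r + (s + j)))).toNat +
          (j + D).choose D ≤ (s + j + D).choose D := by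
        intro j
        have hbj : Ideal.span {b} * Q ^ j ≤ Q ^ (s + j) := by
          rw [pow_add]
          exact Ideal.mul_mono_left ((Ideal.span_singleton_le_iff_mem _).2 hb)
        have h1 : m * Q ^ (s + j) ⊔ Ideal.span {b} * Q ^ j ≤
            Submodule.comap (LinearMap.mulLeft R c) (U (r + (s + j))) := by
          refine sup_le (hmQ _) ?_
          rw [Ideal.span_singleton_mul_le_iff]
          intro x hx
          change c * (b * x) ∈ U (r + (s + j))
          have h2 : ∀ j, Q ^ j * U (r + s) ≤ U (r + (s + j)) := by
            intro j
            induction j with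
            | zero => simp
            | succ j ih =>
              rw [pow_succ', mul_assoc]
              exact (Ideal.mul_mono_right ih).trans (hU _)
          have h3 := h2 j (Ideal.mul_mem_mul hx hbc)
          rwa [show c * (b * x) = x * (b * c) by ring]
        have h2 := relLen_add (le_sup_left : m * Q ^ (s + j) ≤ m * Q ^ (s + j) ⊔ _)
          (sup_le Ideal.mul_le_right hbj)
        rw [relLen_sup_span_mul, hh] at h2
        have h3 : ((j + D).choose D : ℕ) ≤
            relLen (Submodule.comap (LinearMap.mulLeft R b) (m * Q ^ (s + j))) (Q ^ j) := by
          rw [← hh j, ← relLen_inf (Submodule.comap _ _)]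
          refine relLen_le_left ?_ _
          intro x hx
          have hx1 : b * x ∈ m * Q ^ (s + j) := hx.1
          have h4 : reesMonomial hb * reesMonomial hx.2 ∈ p := by
            rw [hp]
            intro n
            change ((monomial s b : R[X]) * monomial j x).coeff n ∈ _
            rw [monomial_mul_monomial, coeff_monomial]
            split_ifs with h
            · exact h ▸ hx1
            · exact zero_mem _
          have h5 := (Ideal.IsPrime.mem_or_mem inferInstance h4).resolve_left ht
          simpa [reesMonomial] using (hp _).1 h5 j
        rw [hrel]
        have h4 := (add_le_add h3 (relLen_le_left h1 (Q ^ (s + j)))).trans h2.le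
        have h5 : relLen (Submodule.comap (LinearMap.mulLeft R c) (U (r + (s + j)))) (Q ^ (s + j)) ≠
            ⊤ := by
          refine ne_top_of_le_ne_top ?_ (le_add_self.trans h4)
          exact ENat.natCast_ne_top _
        obtain ⟨l, hl⟩ := ENat.ne_top_iff_exists.1 h5
        rw [← hl] at h4 ⊢
        rw [ENat.toNat_natCast]
        have h6 : (j + D).choose D + l ≤ (s + j + D).choose D := by exact_mod_cast h4
        omega
      rw [← tendsto_add_atTop_iff_nat (r + s), Nat.cast_zero, zero_div]
      have hlim := (tendsto_choose_div_pow D (s + D) (r + s)).sub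
        (tendsto_choose_div_pow D D (r + s))
      rw [sub_self] at hlim
      refine squeeze_zero (fun j => by positivity) (fun j => ?_) hlim
      rw [← sub_div]
      refine div_le_div_of_nonneg_right ?_ (by positivity)
      have h1 := hbound j
      rw [show r + (s + j) = j + (r + s) by ring, show s + j + D = j + (s + D) by ring] at h1
      rw [le_sub_iff_add_le]
      exact_mod_cast h1

include hp hh in
/-- Every finitely generated graded `ℛ(Q)`-module `W / V` whose components are annihilated by
powers of `m` has a rank at `p = m ℛ(Q)`. -/
theorem hasRank_of_wellFoundedGT {l : List R}
    (hl : ∀ U : ℕ → Ideal R, ClosedUnder l U ↔ ∀ n, Q * U n ≤ U (n + 1)) {V W : ℕ → Ideal R}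
    (hVW : V ≤ W) (hV : ∀ n, Q * V n ≤ V (n + 1)) (hW : ∀ n, Q * W n ≤ W (n + 1))
    (hwf : WellFoundedGT (Between l V W)) (hfin : ∀ n, relLen (V n) (W n) ≠ ⊤)
    (hm : ∀ n, ∃ N, m ^ N ≤ V n) : HasRank p D V W hV hW := by
  -- Noetherian induction: a largest `U` for which `U/V` has a rank must be `W`, since otherwise one
  -- more cyclic piece could be adjoined.
  obtain ⟨U, hU, hmax⟩ := hwf.wf.has_min
    {U : Between l V W | HasRank p D V U.1 hV ((hl _).1 U.2.2.2)}
    ⟨⟨V, le_rfl, hVW, (hl _).2 hV⟩, HasRank.refl p V hV⟩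
  have hUc := (hl _).1 U.2.2.2
  by_cases hUW : W ≤ U.1
  · have : U.1 = W := le_antisymm U.2.2.1 hUW
    have hU' : HasRank p D V U.1 hV hUc := hU
    simp only [this] at hU'
    exact hU'
  exfalso
  obtain ⟨n, hn⟩ : ∃ n, ¬ W n ≤ U.1 n := by
    by_contra h
    push Not at h
    exact hUW h
  have hex : ∃ N, m ^ N * W n ≤ U.1 n := by
    obtain ⟨N, hN⟩ := hm n
    exact ⟨N, Ideal.mul_le_right.trans' (le_of_eq (mul_comm _ _)) |>.trans
      (hN.trans (U.2.1 n))⟩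
  classical
  -- Take the least exponent `i + 1` with `m^{i+1} W n ⊆ U n`. Any `c ∈ m^i W n` outside `U n` is
  -- then a new element with `mc ⊆ U n`.
  obtain ⟨i, hi⟩ : ∃ i, Nat.find hex = i + 1 := by
    refine Nat.exists_eq_succ_of_ne_zero fun h0 => hn ?_
    have := Nat.find_spec hex
    rwa [h0, pow_zero, Ideal.one_eq_top, Ideal.top_mul] at this
  have h1 : ¬ m ^ i * W n ≤ U.1 n := Nat.find_min hex (by omega)
  have h2 := Nat.find_spec hex
  rw [hi, pow_succ', mul_assoc] at h2
  obtain ⟨c, hc, hcU⟩ := SetLike.not_le_iff_exists.1 h1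
  have hstep := hasRank_adjoinMonomial hp hh hUc (r := n) (c := c)
    fun x hx => h2 (Ideal.mul_mem_mul hx hc)
  have hle := adjoinMonomial_le (Q := Q) U.2.2.1 hW (Ideal.mul_le_right hc)
  have hle' := le_adjoinMonomial (Q := Q) U.1 n c
  refine hmax ⟨adjoinMonomial Q U.1 n c, U.2.1.trans hle', hle,
    (hl _).2 (adjoinMonomial_closed hUc n c)⟩ ?_ ?_
  · exact HasRank.trans hU hstep U.2.1 hle' fun i =>
      ne_top_of_le_ne_top (hfin i) (relLen_le_right _ (hle i))
  · exact lt_of_le_not_ge hle' fun h => hcU (h n (mem_adjoinMonomial U.1 n c))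

end Rank

end SallySum

namespace SallySum

/-! ### Hilbert coefficients and the formula for local rings -/

section HilbertCoefficients

open IsLocalRing Topology

lemma exists_isHilbertCoeffs {R : Type*} [CommRing R] {I : Ideal R} {s : ℕ}
    (hdim : ringKrullDim R = s) (hfin : ∀ n, relLen (I ^ n) ⊤ ≠ ⊤)
    (h : EvPoly s fun n => ((relLen (I ^ (n + 1)) (I ^ n)).toNat : ℤ)) :
    ∃ e, IsHilbertCoeffs I e := by
  obtain ⟨c, hc⟩ := h.of_diff (f := fun n => ((relLen (I ^ (n + 1)) ⊤).toNat : ℤ))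
    (Eventually.of_forall fun n => by
      have h1 := congr_arg ENat.toNat (relLen_add
        (Ideal.pow_le_pow_right (Nat.le_succ (n + 1)) : I ^ (n + 1 + 1) ≤ I ^ (n + 1)) le_top)
      rw [ENat.toNat_add (ne_top_of_le_ne_top (hfin _) (relLen_le_right _ le_top)) (hfin _)] at h1
      omega)
  refine ⟨fun i => if i ≤ s then (-1) ^ i * c (s - i) else 0, s, hdim,
    fun i hi => if_neg (by omega), ?_⟩
  filter_upwards [hc] with n hn
  refine ⟨(relLen (I ^ (n + 1)) ⊤).toNat, ?_, ?_⟩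
  · rw [← relLen_top, ENat.natCast_toNat (hfin _)]
  · rw [hn, ← Finset.sum_range_reflect]
    refine Finset.sum_congr rfl fun i hi => ?_
    have hi' : i ≤ s := by have := Finset.mem_range.1 hi; omega
    rw [if_pos hi', show s + 1 - 1 - i = s - i by omega, show n + (s - i) = n + s - i by omega,
      ← mul_assoc ((-1) ^ i), ← mul_pow]
    simp

/-- Once the term of `e 0` is removed, only that of `e 1` has degree `D`. The offset `b` allows both
Hilbert polynomials to be divided by the same `(n+1)^D`. -/
lemma tendsto_hilbertPoly (D b : ℕ) (e : ℕ → ℤ) :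
    Tendsto (fun n : ℕ => (((∑ i ∈ Finset.range (D + 1 + 1),
      (-1) ^ i * e i * ((n + (D + 1) - i).choose (D + 1 - i) : ℤ) : ℤ) : ℝ) -
        e 0 * ((n + (D + 1)).choose (D + 1) : ℝ)) / ((n + b : ℕ) : ℝ) ^ D) atTop
      (𝓝 (-e 1 / (D.factorial : ℝ))) := by
  have h1 : ∀ i ∈ Finset.range (D + 1), Tendsto (fun n : ℕ => (-1 : ℝ) ^ (i + 1) * e (i + 1) *
      ((n + (D - i)).choose (D - i) / ((n + b : ℕ) : ℝ) ^ D)) atTop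
      (𝓝 (if i = 0 then -e 1 / (D.factorial : ℝ) else 0)) := by
    intro i hi
    have hi' : i ≤ D := by have := Finset.mem_range.1 hi; omega
    have h2 := tendsto_choose_div_pow (D - i) (D - i) b
    have h3 : Tendsto (fun n : ℕ => (((n + b : ℕ) : ℝ) ^ i)⁻¹) atTop
        (𝓝 (if i = 0 then 1 else 0)) := by
      split_ifs with h
      · simp [h]
      · exact ((tendsto_pow_atTop h).comp
          (tendsto_natCast_atTop_atTop.comp (tendsto_add_atTop_nat b))).inv_tendsto_atTop
    have h4 := (h2.mul h3).const_mul ((-1 : ℝ) ^ (i + 1) * e (i + 1))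
    have h5 : (-1 : ℝ) ^ (i + 1) * e (i + 1) *
        (1 / ((D - i).factorial : ℝ) * if i = 0 then 1 else 0) =
        if i = 0 then -e 1 / (D.factorial : ℝ) else 0 := by
      split_ifs with h
      · subst h
        simp only [zero_add, Nat.sub_zero]
        ring
      · ring
    rw [h5] at h4
    refine h4.congr fun n => ?_
    have h6 : ((n + b : ℕ) : ℝ) ^ D = ((n + b : ℕ) : ℝ) ^ (D - i) * ((n + b : ℕ) : ℝ) ^ i := by
      rw [← pow_add, Nat.sub_add_cancel hi']
    rw [h6, ← div_eq_mul_inv, div_div]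
  have h2 := tendsto_finsetSum _ h1
  rw [Finset.sum_ite_eq' (Finset.range (D + 1)) 0, if_pos (by simp)] at h2
  refine h2.congr fun n => ?_
  rw [Finset.sum_range_succ' _ (D + 1)]
  push_cast
  simp only [one_mul, Nat.sub_zero, add_sub_cancel_right]
  rw [Finset.sum_div]
  refine Finset.sum_congr rfl fun i hi => ?_
  have hi' : i ≤ D := by have := Finset.mem_range.1 hi; omega
  rw [show n + (D + 1) - (i + 1) = n + (D - i) by omega, mul_div_assoc]

lemma coeff_identity {D l : ℕ} {e e' : ℕ → ℤ} {S : ℕ → ℕ}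
    (hS : Tendsto (fun n : ℕ => (S n : ℝ) / (n : ℝ) ^ D) atTop (𝓝 (l / (D.factorial : ℝ))))
    (h : ∀ᶠ n : ℕ in atTop, (S (n + 1) : ℤ) = ((n + 1 + D).choose D : ℕ) +
      (∑ i ∈ Finset.range (D + 1 + 1), (-1) ^ i * e i *
        ((n + (D + 1) - i).choose (D + 1 - i) : ℤ)) -
      ∑ i ∈ Finset.range (D + 1 + 1), (-1) ^ i * e' i *
        ((n + 1 + (D + 1) - i).choose (D + 1 - i) : ℤ)) :
    e 1 + l = e' 1 - e' 0 + 1 := by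
  have t1 := hS.comp (tendsto_add_atTop_nat 1)
  have t2 := tendsto_choose_div_pow D (1 + D) 1
  have t3 := tendsto_hilbertPoly D 1 e
  have t4 := (tendsto_hilbertPoly D 0 e').comp (tendsto_add_atTop_nat 1)
  have t5 := ((((t1.sub t2).sub t3).add t4).add (t2.const_mul (e' 0 : ℝ)))
  -- The `e'` polynomial is taken at `n + 1`, one step beyond that of `e`. Pascal's rule turns this
  -- shift into `-e' 0 * binom(n+1+D, D)`, the source of `e₀` in the formula.
  have key : Tendsto (fun n : ℕ => ((e 0 : ℝ) - e' 0) * (((n + (D + 1)).choose (D + 1) : ℝ) /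
      ((n + 1 : ℕ) : ℝ) ^ D)) atTop (𝓝 (((l : ℝ) - 1 + e 1 - e' 1 + e' 0) / D.factorial)) := by
    have hL : (l : ℝ) / D.factorial - 1 / D.factorial - -e 1 / D.factorial +
        -e' 1 / D.factorial + e' 0 * (1 / D.factorial) =
        ((l : ℝ) - 1 + e 1 - e' 1 + e' 0) / D.factorial := by ring
    rw [hL] at t5
    refine t5.congr' ?_
    filter_upwards [h] with n hn
    have hn' : (S (n + 1) : ℝ) = ((n + 1 + D).choose D : ℕ) +
      ((∑ i ∈ Finset.range (D + 1 + 1), (-1) ^ i * e i *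
        ((n + (D + 1) - i).choose (D + 1 - i) : ℤ) : ℤ) : ℝ) -
      ((∑ i ∈ Finset.range (D + 1 + 1), (-1) ^ i * e' i *
        ((n + 1 + (D + 1) - i).choose (D + 1 - i) : ℤ) : ℤ) : ℝ) := by
      exact_mod_cast congr_arg (Int.cast : ℤ → ℝ) hn
    have hb : ((n + 1 + (D + 1)).choose (D + 1) : ℝ) =
        (n + (D + 1)).choose (D + 1) + (n + 1 + D).choose D := by
      rw [show n + 1 + (D + 1) = n + 1 + D + 1 by ring, Nat.choose_succ_succ,
        show n + (D + 1) = n + 1 + D by ring]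
      push_cast
      ring
    simp only [Function.comp, add_zero]
    rw [hn', hb, show n + (1 + D) = n + 1 + D by ring]
    ring
  -- A multiple of a polynomial of degree `D + 1` divided by `(n+1)^D` has a finite limit, so the
  -- factor vanishes: the multiplicities agree.
  have he : (e 0 : ℝ) - e' 0 = 0 := by
    have k1 := (tendsto_choose_div_pow (D + 1) (D + 1) 1).const_mul ((e 0 : ℝ) - e' 0)
    have k2 : Tendsto (fun n : ℕ => (((n + 1 : ℕ) : ℝ))⁻¹) atTop (𝓝 0) :=
      (tendsto_natCast_atTop_atTop.comp (tendsto_add_atTop_nat 1)).inv_tendsto_atTop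
    have k3 := key.mul k2
    rw [mul_zero] at k3
    have k4 := tendsto_nhds_unique k1 (k3.congr fun n => by
      rw [pow_succ, ← div_div, div_eq_mul_inv _ ((n + 1 : ℕ) : ℝ), mul_assoc])
    have k5 : (1 / ((D + 1).factorial : ℝ)) ≠ 0 := by positivity
    exact (mul_eq_zero.1 k4).resolve_right k5
  rw [he] at key
  simp only [zero_mul] at key
  have h0 := tendsto_nhds_unique key tendsto_const_nhds
  have hD : (D.factorial : ℝ) ≠ 0 := by positivity
  have h1 := (div_eq_zero_iff.1 h0).resolve_right hD
  have h2 : ((e 1 + l : ℤ) : ℝ) = ((e' 1 - e' 0 + 1 : ℤ) : ℝ) := by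
    push_cast
    linarith
  exact_mod_cast h2

lemma IsHilbertCoeffs.eventually_relLen {R : Type*} [CommRing R] {I : Ideal R} {e : ℕ → ℤ} {s : ℕ}
    (hdim : ringKrullDim R = s) (h : IsHilbertCoeffs I e) : ∀ᶠ n : ℕ in atTop,
    ((relLen (I ^ (n + 1)) ⊤).toNat : ℤ) =
      ∑ i ∈ Finset.range (s + 1), (-1) ^ i * e i * ((n + s - i).choose (s - i) : ℤ) := by
  obtain ⟨s', hs', -, hn⟩ := h
  obtain rfl : s = s' := by
    rw [hdim] at hs'
    exact_mod_cast hs'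
  filter_upwards [hn] with n ⟨l, hl, hl'⟩
  rw [relLen_top, hl, ENat.toNat_natCast, hl']

variable {R : Type*} [CommRing R] [IsLocalRing R] [IsNoetherianRing R] {D : ℕ}
  (α : Fin (D + 1) → R)

/-- If `Q` is a parameter ideal and a reduction of the maximal ideal `m` of a Noetherian local
ring, then `m` and `Q` have Hilbert polynomials, the localization of the Sally module `S_Q(m)` at
`m ℛ(Q)` has finite length, and `e_1(Q) + ℓ(S_p) = e_1(m) - e_0(m) + 1`. -/
theorem hilbertCoeff_add_sallyLocalLength (hdim : ringKrullDim R = (D + 1 : ℕ))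
    (hQ : Ideal.span (Set.range α) ≤ maximalIdeal R) {r : ℕ}
    (hr : maximalIdeal R ^ (r + 1) = Ideal.span (Set.range α) * maximalIdeal R ^ r) :
    IsHilbertCoeffs (maximalIdeal R) (hilbertCoeff (maximalIdeal R)) ∧
    IsHilbertCoeffs (Ideal.span (Set.range α)) (hilbertCoeff (Ideal.span (Set.range α))) ∧
    ∃ (hp : (reesExtend (Ideal.span (Set.range α)) (maximalIdeal R)).IsPrime) (l : ℕ),
      sallyLocalLength (Ideal.span (Set.range α)) (maximalIdeal R) _ hp = l ∧
      hilbertCoeff (Ideal.span (Set.range α)) 1 + l =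
        hilbertCoeff (maximalIdeal R) 1 - hilbertCoeff (maximalIdeal R) 0 + 1 := by
  set Q := Ideal.span (Set.range α) with hQdef
  set m := maximalIdeal R with hmdef
  have hdim' : ¬ ringKrullDim R ≤ D := by
    rw [hdim, Nat.cast_le]
    omega
  have hc : m ^ (r + 1) ≤ Q := hr.le.trans Ideal.mul_le_left
  have hQpow : ∀ n, m ^ ((r + 1) * n) ≤ Q ^ n := fun n => by
    rw [pow_mul]
    exact Ideal.pow_right_mono hc n
  have hQm : ∀ n, Q ^ n ≤ m ^ n := fun n => Ideal.pow_right_mono hQ n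
  -- One argument serves `m` and `Q`: for `Q ≤ I ≤ m` the graded pieces `I^n/I^{n+1}` form a finite
  -- module over `ℛ(Q)`, generated over `R` by `D + 1` elements of degree one.
  have hhilb : ∀ I : Ideal R, Q ≤ I → I ≤ m → ∃ e, IsHilbertCoeffs I e := by
    intro I hQI hIm
    have hfin : ∀ n W, relLen (I ^ n) W ≠ ⊤ := fun n W =>
      relLen_ne_top ((hQpow n).trans (Ideal.pow_right_mono hQI n)) W
    refine exists_isHilbertCoeffs hdim (fun n => hfin n _) ?_
    have h1 := evPoly_relLen (List.ofFn α) (fun n => I ^ (n + 1)) (fun n => I ^ n)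
      (fun n => Ideal.pow_le_pow_right (Nat.le_succ n))
      (closedUnder_ofFn_iff.2 fun n => by
        rw [pow_succ' I (n + 1)]; exact Ideal.mul_mono_left hQI)
      (closedUnder_ofFn_iff.2 fun n => by
        rw [pow_succ' I n]; exact Ideal.mul_mono_left hQI)
      (between_wellFoundedGT hQ hr fun n => Ideal.pow_right_mono hIm n) (fun n => hfin _ _)
    rwa [List.length_ofFn] at h1
  obtain ⟨eM, heM⟩ := hhilb m hQ le_rfl
  obtain ⟨eQ, heQ⟩ := hhilb Q le_rfl hQ
  rw [heM.hilbertCoeff_eq, heQ.hilbertCoeff_eq]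
  refine ⟨heM, heQ, ?_⟩
  have hp := reesExtend_isPrime α hdim' hQ hc
  have hh := relLen_fiber_eq α hdim' hQ hc
  have hV : ∀ n, Q * (m * Q ^ n) ≤ m * Q ^ (n + 1) := fun n => by
    rw [mul_left_comm, pow_succ']
  have hW : ∀ n, Q * (m * m ^ n) ≤ m * m ^ (n + 1) := fun n => by
    rw [mul_left_comm, pow_succ']
    exact Ideal.mul_mono_right (Ideal.mul_mono_left hQ)
  have hVW : (fun n => m * Q ^ n) ≤ fun n => m * m ^ n := fun n => Ideal.mul_mono_right (hQm n)
  have hVpow : ∀ n, m ^ ((r + 1) * n + 1) ≤ m * Q ^ n := fun n => by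
    rw [pow_succ']
    exact Ideal.mul_mono_right (hQpow n)
  have hfinV : ∀ n W, relLen (m * Q ^ n) W ≠ ⊤ := fun n W => relLen_ne_top (hVpow n) W
  obtain ⟨l, hl, hlim⟩ := hasRank_of_wellFoundedGT (p := reesExtend Q m) (D := D) (m := m)
    mem_reesExtend_iff hh (l := List.ofFn α) (fun _ => closedUnder_ofFn_iff) hVW hV hW
    (between_wellFoundedGT hQ hr fun n => Ideal.mul_le_right) (fun n => hfinV n _)
    (fun n => ⟨_, hVpow n⟩)
  refine ⟨hp, l, ?_, ?_⟩
  · rw [← hl]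
    have e1 : mulRees Q m Q = gsub Q (fun n => m * Q ^ n) hV :=
      Submodule.ext fun f => mem_mulRees_iff le_rfl f
    have e2 : mulRees Q m m = gsub Q (fun n => m * m ^ n) hW :=
      Submodule.ext fun f => mem_mulRees_iff hQ f
    rw [← e1, ← e2]
    exact (localLength_congr _ (Subquotient.equivMap _ _)).symm
  · refine coeff_identity hlim ?_
    filter_upwards [heQ.eventually_relLen hdim,
      eventually_succ_iff.2 (heM.eventually_relLen hdim)] with n h1 h2
    rw [← h1, ← h2]
    have hM : m * m ^ (n + 1) = m ^ (n + 1 + 1) := (pow_succ' m (n + 1)).symm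
    -- The length of `R/mQ^{n+1}` is computed through `m^{n+2}` and through `Q^{n+1}`.
    have a1 := congr_arg ENat.toNat (relLen_add (hVW (n + 1)) le_top)
    have a2 := congr_arg ENat.toNat (relLen_add
      (Ideal.mul_le_right : m * Q ^ (n + 1) ≤ Q ^ (n + 1)) le_top)
    simp only [hM] at a1 ⊢
    rw [ENat.toNat_add (hfinV _ _) (relLen_ne_top (le_refl (m ^ (n + 1 + 1))) _)] at a1
    rw [ENat.toNat_add (hfinV _ _) (relLen_ne_top (hQpow _) _), hh, ENat.toNat_natCast] at a2
    omega

end HilbertCoefficients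

end SallySum

namespace SallySum

/-! ### The ring `A = k + J` -/

section KPlus

open IsLocalRing

variable {k B : Type*} [Field k] [CommRing B] [Algebra k B] {J : Ideal B}

lemma mem_kPlus_of_mem {x : B} (hx : x ∈ J) : x ∈ kPlus k J :=
  ⟨0, x, hx, by simp⟩

/-- Positive powers of `J` in `B` and of `𝔪` in `A` are the same sets; exponent `0` is excluded
because `A` may be smaller than `B`. -/
lemma exists_mem_pow_eq {n : ℕ} {b : B} (hb : b ∈ J ^ (n + 1)) :
    ∃ x ∈ kPlusMax k J ^ (n + 1), (x : B) = b := by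
  induction n generalizing b with
  | zero =>
    rw [zero_add, pow_one] at hb ⊢
    exact ⟨⟨b, mem_kPlus_of_mem hb⟩, hb, rfl⟩
  | succ n ih =>
    rw [pow_succ J] at hb
    rw [pow_succ (kPlusMax k J)]
    induction hb using Submodule.mul_induction_on' with
    | mem_mul_mem x hx y hy =>
      obtain ⟨x', hx', rfl⟩ := ih hx
      exact ⟨x' * ⟨y, mem_kPlus_of_mem hy⟩, Ideal.mul_mem_mul hx' hy, rfl⟩
    | add x _ y _ hx hy =>
      obtain ⟨x', hx', rfl⟩ := hx
      obtain ⟨y', hy', rfl⟩ := hy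
      exact ⟨x' + y', add_mem hx' hy', rfl⟩

lemma coe_mem_pow {n : ℕ} {x : kPlus k J} (hx : x ∈ kPlusMax k J ^ n) : (x : B) ∈ J ^ n := by
  have h1 : (kPlusMax k J).map (kPlus k J).val ≤ J := Ideal.map_comap_le
  have h2 := Ideal.mem_map_of_mem (kPlus k J).val hx
  rw [Ideal.map_pow] at h2
  exact Ideal.pow_right_mono h1 n h2

/-- The reduction property descends to `A` at the cost of one more exponent. A coefficient from `B`
on a generator `a i` is absorbed by the factor in `J^{n+1}`, a `B`-ideal contained in `A`. -/
lemma kPlusMax_pow_eq {d : ℕ} {a : Fin d → B} {n : ℕ}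
    (h : J ^ (n + 1) = Ideal.span (Set.range a) * J ^ n) (hle : Ideal.span (Set.range a) ≤ J) :
    kPlusMax k J ^ (n + 1 + 1) = kPlusSpan k J a * kPlusMax k J ^ (n + 1) := by
  have haJ : ∀ i, a i ∈ J := fun i => hle (Ideal.subset_span ⟨i, rfl⟩)
  have hQm : kPlusSpan k J a ≤ kPlusMax k J := by
    refine Ideal.span_le.2 ?_
    rintro x ⟨i, hi⟩
    change (x : B) ∈ J
    exact hi ▸ haJ i
  refine le_antisymm ?_ ?_
  · have key : ∀ q ∈ Ideal.span (Set.range a), ∀ y ∈ J ^ (n + 1),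
        ∃ x ∈ kPlusSpan k J a * kPlusMax k J ^ (n + 1), (x : B) = q * y := by
      intro q hq
      induction hq using Submodule.span_induction with
      | mem q hq =>
        obtain ⟨i, rfl⟩ := hq
        intro y hy
        obtain ⟨y', hy', rfl⟩ := exists_mem_pow_eq (k := k) hy
        exact ⟨⟨a i, mem_kPlus_of_mem (haJ i)⟩ * y',
          Ideal.mul_mem_mul (Ideal.subset_span ⟨i, rfl⟩) hy', rfl⟩
      | zero => exact fun y _ => ⟨0, zero_mem _, by simp⟩
      | add q q' _ _ hq hq' =>
        intro y hy
        obtain ⟨x, hx, hxy⟩ := hq y hy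
        obtain ⟨x', hx', hxy'⟩ := hq' y hy
        exact ⟨x + x', add_mem hx hx', by rw [add_mul, ← hxy, ← hxy']; rfl⟩
      | smul c q _ hq =>
        intro y hy
        obtain ⟨x, hx, hxy⟩ := hq (c * y) (Ideal.mul_mem_left _ _ hy)
        exact ⟨x, hx, by rw [hxy, smul_eq_mul]; ring⟩
    intro x hx
    have hx' := coe_mem_pow hx
    have h2 : J ^ (n + 1 + 1) = Ideal.span (Set.range a) * J ^ (n + 1) := by
      rw [pow_succ, h, mul_assoc, ← pow_succ]
      rw [h]
    rw [h2] at hx'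
    obtain ⟨z, hz, hzx⟩ : ∃ z ∈ kPlusSpan k J a * kPlusMax k J ^ (n + 1), (z : B) = x := by
      generalize (x : B) = b at hx'
      induction hx' using Submodule.mul_induction_on' with
      | mem_mul_mem q hq y hy => exact key q hq y hy
      | add u _ v _ hu hv =>
        obtain ⟨u', hu', rfl⟩ := hu
        obtain ⟨v', hv', rfl⟩ := hv
        exact ⟨u' + v', add_mem hu' hv', rfl⟩
    rwa [← Subtype.ext hzx]
  · rw [pow_succ' _ (n + 1)]
    exact Ideal.mul_mono_left hQm

variable [IsLocalRing B]

lemma exists_sub_mem_maximalIdeal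
    (hk : Function.Surjective (fun c : k => residue B (algebraMap k B c))) (b : B) :
    ∃ c : k, b - algebraMap k B c ∈ maximalIdeal B := by
  obtain ⟨c, hc⟩ := hk (residue B b)
  refine ⟨c, ?_⟩
  rw [← residue_eq_zero_iff, map_sub, ← hc, sub_self]

lemma isIntegral_kPlus (hk : Function.Surjective (fun c : k => residue B (algebraMap k B c)))
    (hJ : J.radical = maximalIdeal B) : Algebra.IsIntegral (kPlus k J) B := by
  refine ⟨fun b => ?_⟩
  obtain ⟨c, hc⟩ := exists_sub_mem_maximalIdeal hk b
  rw [← hJ] at hc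
  obtain ⟨n, hn⟩ := hc
  have h1 : IsIntegral (kPlus k J) (b - algebraMap k B c) := by
    refine IsIntegral.of_pow (n := n + 1) (Nat.succ_pos n) ?_
    have h2 : (b - algebraMap k B c) ^ (n + 1) ∈ J := by
      rw [pow_succ]
      exact Ideal.mul_mem_right _ _ hn
    exact isIntegral_algebraMap (x := (⟨_, mem_kPlus_of_mem h2⟩ : kPlus k J))
  have h2 : IsIntegral (kPlus k J) (algebraMap k B c) :=
    isIntegral_algebraMap (x := algebraMap k (kPlus k J) c)
  have := h1.add h2
  rwa [sub_add_cancel] at this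

variable [IsNoetherianRing B]

/-- As `k` is the residue field, generators of `𝔫^n` over `B` span `𝔫^n` over `k` modulo `𝔫^{n+1}`.
Hence `B/𝔫^n` is finite-dimensional. -/
lemma exists_fg_sup_pow_eq_top
    (hk : Function.Surjective (fun c : k => residue B (algebraMap k B c))) (n : ℕ) :
    ∃ E : Submodule k B, E.FG ∧ ∀ b : B, ∃ e ∈ E, b - e ∈ maximalIdeal B ^ n := by
  induction n with
  | zero => exact ⟨⊥, Submodule.fg_bot, fun b => ⟨0, zero_mem _, by simp⟩⟩
  | succ n ih =>
    obtain ⟨E, hE, h⟩ := ih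
    obtain ⟨S, hS⟩ := (isNoetherianRing_iff_ideal_fg B).1 inferInstance (maximalIdeal B ^ n)
    refine ⟨E ⊔ Submodule.span k S, hE.sup (Submodule.fg_span S.finite_toSet), fun b => ?_⟩
    obtain ⟨e, he, hbe⟩ := h b
    have key : ∀ x ∈ maximalIdeal B ^ n, ∃ y ∈ Submodule.span k (S : Set B),
        x - y ∈ maximalIdeal B ^ (n + 1) := by
      intro x hx
      have hS' : Ideal.span (S : Set B) = maximalIdeal B ^ n := hS
      rw [← hS'] at hx
      induction hx using Submodule.span_induction with
      | mem x hx => exact ⟨x, Submodule.subset_span hx, by simp⟩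
      | zero => exact ⟨0, zero_mem _, by simp⟩
      | add x x' _ _ hx hx' =>
        obtain ⟨y, hy, hxy⟩ := hx
        obtain ⟨y', hy', hxy'⟩ := hx'
        exact ⟨y + y', add_mem hy hy', by rw [add_sub_add_comm]; exact add_mem hxy hxy'⟩
      | smul a x hx' hx =>
        obtain ⟨y, hy, hxy⟩ := hx
        obtain ⟨c, hc⟩ := exists_sub_mem_maximalIdeal hk a
        refine ⟨c • y, Submodule.smul_mem _ _ hy, ?_⟩
        have hxn : x ∈ maximalIdeal B ^ n := hS' ▸ hx'
        have h1 : a • x - c • y = (a - algebraMap k B c) * x + algebraMap k B c * (x - y) := by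
          rw [smul_eq_mul, Algebra.smul_def c y]
          ring
        rw [h1]
        refine add_mem ?_ (Ideal.mul_mem_left _ _ hxy)
        rw [pow_succ']
        exact Ideal.mul_mem_mul hc hxn
    obtain ⟨y, hy, hxy⟩ := key _ hbe
    exact ⟨e + y, Submodule.add_mem_sup he hy, by rwa [← sub_sub]⟩

lemma exists_fg_sup_eq_top
    (hk : Function.Surjective (fun c : k => residue B (algebraMap k B c)))
    (hJ : J.radical = maximalIdeal B) :
    ∃ E : Submodule k B, E.FG ∧ ∀ b : B, ∃ e ∈ E, b - e ∈ J := by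
  obtain ⟨n, hn⟩ := Ideal.exists_radical_pow_le_of_fg J
    ((isNoetherianRing_iff_ideal_fg B).1 inferInstance _)
  obtain ⟨E, hE, h⟩ := exists_fg_sup_pow_eq_top hk n
  refine ⟨E, hE, fun b => ?_⟩
  obtain ⟨e, he, hb⟩ := h b
  exact ⟨e, he, hn (hJ ▸ hb)⟩

/-- Write `B = E + J` with `E` finite-dimensional over `k`, and choose finitely many `x ∈ I`
generating `IB`. Then `IB` is the sum of the `xE` and the `xJ`, and `xJ ⊆ xA ⊆ I`. So `I` is
generated by these `x` together with its part in the finite-dimensional space `∑ xE`. -/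
lemma isNoetherianRing_kPlus
    (hk : Function.Surjective (fun c : k => residue B (algebraMap k B c)))
    (hJ : J.radical = maximalIdeal B) : IsNoetherianRing (kPlus k J) := by
  obtain ⟨E, hE, h⟩ := exists_fg_sup_eq_top hk hJ
  obtain ⟨SE, hSE⟩ := hE
  refine (isNoetherianRing_iff_ideal_fg _).2 fun I => ?_
  obtain ⟨X, hXI, hX⟩ := (Submodule.fg_span_iff_fg_span_finset_subset
    ((kPlus k J).val '' (I : Set (kPlus k J)))).1
    ((isNoetherianRing_iff_ideal_fg B).1 inferInstance (Ideal.span _))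
  classical
  let L : Submodule k B := ⨆ x ∈ X, E.map (LinearMap.mulLeft k x)
  have hLfg : L.FG := Submodule.fg_biSup X _ fun x _ => (Submodule.FG.map _ ⟨SE, hSE⟩)
  have : Module.Finite k L := Module.Finite.iff_fg.2 hLfg
  let L' : Submodule k (kPlus k J) := (I.restrictScalars k) ⊓ L.comap (kPlus k J).val.toLinearMap
  have hL' : L'.FG := by
    rw [← Module.Finite.iff_fg]
    refine Module.Finite.of_injective (((kPlus k J).val.toLinearMap.comp L'.subtype).codRestrict L
      fun x => x.2.2) ?_
    intro x y hxy
    have h' := congr_arg (Subtype.val : L → B) hxy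
    exact Subtype.ext (Subtype.ext h')
  obtain ⟨S, hS⟩ := hL'
  have hXA : ∀ x ∈ X, ∃ y ∈ I, (y : B) = x := fun x hx => hXI hx
  choose! g hgI hg using hXA
  refine ⟨X.image g ∪ S, le_antisymm ?_ ?_⟩
  · refine Submodule.span_le.2 ?_
    intro y hy
    rcases Finset.mem_union.1 hy with hy | hy
    · obtain ⟨x, hx, rfl⟩ := Finset.mem_image.1 hy
      exact hgI x hx
    · have : y ∈ L' := hS ▸ Submodule.subset_span hy
      exact this.1
  · intro y hy
    set P : Ideal (kPlus k J) := Submodule.span _ ((X.image g ∪ S : Finset _) : Set (kPlus k J))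
    have hyB : (y : B) ∈ Ideal.span (X : Set B) :=
      hX.le (Submodule.subset_span ⟨y, hy, rfl⟩)
    have key : ∀ b ∈ Ideal.span (X : Set B), ∃ e ∈ L, ∃ z ∈ P, z ∈ I ∧ (z : B) = b - e := by
      intro b hb
      induction hb using Submodule.closure_induction with
      | zero => exact ⟨0, zero_mem _, 0, zero_mem _, zero_mem _, by simp⟩
      | add b b' _ _ hb hb' =>
        obtain ⟨e, he, z, hz, hzI, h⟩ := hb
        obtain ⟨e', he', z', hz', hzI', h'⟩ := hb'
        exact ⟨e + e', add_mem he he', z + z', add_mem hz hz', add_mem hzI hzI', by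
          rw [add_sub_add_comm, ← h, ← h']; rfl⟩
      | smul_mem b x hx =>
        obtain ⟨e, he, hbe⟩ := h b
        refine ⟨x * e, Submodule.mem_iSup_of_mem x (Submodule.mem_iSup_of_mem hx ⟨e, he, rfl⟩),
          ⟨b - e, mem_kPlus_of_mem hbe⟩ * g x, Ideal.mul_mem_left _ _ (Submodule.subset_span
            (Finset.mem_union_left _ (Finset.mem_image_of_mem _ hx))),
          Ideal.mul_mem_left _ _ (hgI x hx), ?_⟩
        change (b - e) * (g x : B) = b • x - x * e
        rw [hg x hx, smul_eq_mul]
        ring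
    obtain ⟨e, he, z, hz, hzI, hzy⟩ := key y hyB
    have h1 : y - z ∈ L' := by
      refine ⟨sub_mem hy hzI, ?_⟩
      change (y : B) - (z : B) ∈ L
      rwa [hzy, sub_sub_cancel]
    have h2 : y - z ∈ P := by
      rw [← hS] at h1
      exact Submodule.span_le_restrictScalars k (kPlus k J) _ h1 |> fun h => 
        Submodule.span_mono (by intro s hs; exact Finset.mem_union_right _ hs) h
    have := add_mem h2 hz
    rwa [sub_add_cancel] at this

/-- Incomparability: contraction of primes along an integral extension is strictly monotone. -/
lemma ringKrullDim_le_of_isIntegral {R S : Type*} [CommRing R] [CommRing S] [Algebra R S]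
    [Algebra.IsIntegral R S] : ringKrullDim S ≤ ringKrullDim R :=
  Order.krullDim_le_of_strictMono (fun P => PrimeSpectrum.comap (algebraMap R S) P)
    fun P _ h => have := P.2; Ideal.IsIntegral.comap_lt_comap (I := P.asIdeal) h

lemma ringKrullDim_le_card {R : Type*} [CommRing R] [IsLocalRing R] [IsNoetherianRing R] {d : ℕ}
    (α : Fin d → R) (hα : Ideal.span (Set.range α) ≤ maximalIdeal R) {n : ℕ}
    (hn : maximalIdeal R ^ n ≤ Ideal.span (Set.range α)) : ringKrullDim R ≤ d := by
  have h1 : maximalIdeal R ∈ (Ideal.span (Set.range α)).minimalPrimes :=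
    ⟨⟨inferInstance, hα⟩, fun P hP _ => hP.1.le_of_pow_le (hn.trans hP.2)⟩
  rw [← IsLocalRing.maximalIdeal_height_eq_ringKrullDim]
  have h2 := Ideal.height_le_card_of_mem_minimalPrimes_span (Set.finite_range α) h1
  have h3 : (Set.range α).ncard ≤ d := by
    rw [← Set.image_univ]
    exact (Set.ncard_image_le Set.finite_univ).trans (by simp [Set.ncard_univ])
  exact_mod_cast h2.trans (Nat.cast_le.2 h3)

/-- The formula `e_1(Q) + ℓ(S_p) = e_1(m) - e_0(m) + 1` for `A = k + J` and `Q = (a)A`. -/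
lemma kPlus_hilbertCoeff_add_sallyLocalLength
    (hk : Function.Surjective (fun c : k => residue B (algebraMap k B c)))
    (hJ : J.radical = maximalIdeal B) {d : ℕ} (hd : 0 < d) {a : Fin d → B}
    (hdim : ringKrullDim B = d) (hred : IsReduction (Ideal.span (Set.range a)) J) :
    ringKrullDim (kPlus k J) = d ∧
    IsHilbertCoeffs (kPlusMax k J) (hilbertCoeff (kPlusMax k J)) ∧
    IsHilbertCoeffs (kPlusSpan k J a) (hilbertCoeff (kPlusSpan k J a)) ∧
    ∃ (hp : (reesExtend (kPlusSpan k J a) (kPlusMax k J)).IsPrime) (l : ℕ),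
      sallyLocalLength (kPlusSpan k J a) (kPlusMax k J) _ hp = l ∧
      hilbertCoeff (kPlusSpan k J a) 1 + l =
        hilbertCoeff (kPlusMax k J) 1 - hilbertCoeff (kPlusMax k J) 0 + 1 := by
  obtain ⟨D, rfl⟩ : ∃ D, d = D + 1 := ⟨d - 1, by omega⟩
  obtain ⟨hle, n, hn⟩ := hred
  have hJtop : J ≠ ⊤ := by
    rintro rfl
    rw [Ideal.radical_top] at hJ
    exact (maximalIdeal.isMaximal B).ne_top hJ.symm
  have := isLocalRing_kPlus k J hJtop
  have := isNoetherianRing_kPlus hk hJ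
  have := isIntegral_kPlus hk hJ
  have hmax := maximalIdeal_kPlus k J hJtop
  have haJ : ∀ i, a i ∈ J := fun i => hle (Ideal.subset_span ⟨i, rfl⟩)
  let α : Fin (D + 1) → kPlus k J := fun i => ⟨a i, mem_kPlus_of_mem (haJ i)⟩
  have hspan : Ideal.span (Set.range α) = kPlusSpan k J a := by
    rw [kPlusSpan]
    congr 1
    ext x
    exact ⟨fun ⟨i, hi⟩ => ⟨i, hi ▸ rfl⟩, fun ⟨i, hi⟩ => ⟨i, Subtype.ext hi.symm⟩⟩
  have hr := kPlusMax_pow_eq (k := k) hn hle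
  rw [← hmax, ← hspan] at hr
  have hQ : Ideal.span (Set.range α) ≤ maximalIdeal (kPlus k J) := by
    rw [hmax]
    refine Ideal.span_le.2 ?_
    rintro _ ⟨i, rfl⟩
    exact haJ i
  -- The upper bound is Krull's height theorem for the `𝔪`-primary ideal `(α)`; the lower bound
  -- holds because `B` is integral over `A`.
  have hdimA : ringKrullDim (kPlus k J) = (D + 1 : ℕ) := by
    refine le_antisymm (ringKrullDim_le_card α hQ (hr.le.trans Ideal.mul_le_left)) ?_
    rw [← hdim]
    exact ringKrullDim_le_of_isIntegral
  have main := hilbertCoeff_add_sallyLocalLength α hdimA hQ hr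
  rw [hmax, hspan] at main
  exact ⟨hdimA, main⟩

end KPlus

end SallySum

/-! ### Comparison of the two reductions -/

theorem mainTheorem10 {k B : Type*} [Field k] [CommRing B] [IsLocalRing B] [IsNoetherianRing B]
    [Algebra k B]
    (hk : Function.Bijective (fun c : k => IsLocalRing.residue B (algebraMap k B c)))
    (J : Ideal B) (hJ : J.IsPrimary) (hJrad : J.radical = IsLocalRing.maximalIdeal B)
    (d : ℕ) (hd : 0 < d) (a a' : Fin d → B)
    (ha : SallySum.IsSystemOfParameters a) (ha' : SallySum.IsSystemOfParameters a')
    (hred : SallySum.IsReduction (Ideal.span (Set.range a)) J)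
    (hred' : SallySum.IsReduction (Ideal.span (Set.range a')) J) :
    let A := SallySum.kPlus k J
    let m : Ideal A := SallySum.kPlusMax k J
    let Q : Ideal A := SallySum.kPlusSpan k J a
    let Q' : Ideal A := SallySum.kPlusSpan k J a'
    let p : Ideal (reesAlgebra Q) := SallySum.reesExtend Q m
    let p' : Ideal (reesAlgebra Q') := SallySum.reesExtend Q' m
    IsNoetherianRing A ∧ ringKrullDim A = d ∧
    SallySum.IsHilbertCoeffs m (SallySum.hilbertCoeff m) ∧
    SallySum.IsHilbertCoeffs Q (SallySum.hilbertCoeff Q) ∧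
    SallySum.IsHilbertCoeffs Q' (SallySum.hilbertCoeff Q') ∧
    ∃ (hp : p.IsPrime) (hp' : p'.IsPrime) (l l' : ℕ),
      SallySum.sallyLocalLength Q m p hp = l ∧
      SallySum.sallyLocalLength Q' m p' hp' = l' ∧
      SallySum.hilbertCoeff Q 1 + l = SallySum.hilbertCoeff Q' 1 + l' ∧
      SallySum.hilbertCoeff Q' 1 + l' =
        SallySum.hilbertCoeff m 1 - SallySum.hilbertCoeff m 0 + 1 := by
  obtain ⟨hdim, hm, hQ, hp, l, hl, h⟩ :=
    SallySum.kPlus_hilbertCoeff_add_sallyLocalLength hk.2 hJrad hd ha.1 hred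
  obtain ⟨-, -, hQ', hp', l', hl', h'⟩ :=
    SallySum.kPlus_hilbertCoeff_add_sallyLocalLength hk.2 hJrad hd ha'.1 hred'
  exact ⟨SallySum.isNoetherianRing_kPlus hk.2 hJrad, hdim, hm, hQ, hQ', hp, hp', l, l', hl, hl',
    h.trans h'.symm, h'⟩
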